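/- Let $M=(V,d)$ be a finite metric space with a designated initial state $v_0\in V$. In the metrical task system on $M$, a task is a function $t:V\to[0,\infty]$. Serving a finite task sequence $\sigma=(t_1,\dots,t_m)$ along states $u_0=v_0,u_1,\dots,u_m\in V$ costs $\sum_{i=1}^m\bigl(d(u_{i-1},u_i)+t_i(u_i)\bigr)$, and $\mathrm{cost}_{\mathrm{OPT}}(\sigma)$ is the minimum of this cost over all $u_1,\dots,u_m$. A randomized online algorithm $A$ starts in $v_0$ and chooses each state $u_i$ as a function of $t_1,\dots,t_i$ and of random bits only; its expected cost on $\sigma$ is denoted by $\mathrm{E}[\mathrm{cost}_A(\sigma)]$. For a real number $r\ge 0$, $A$ is called $r$-competitive against an oblivious adversary if there is a constant $c$ such that $\mathrm{E}[\mathrm{cost}_A(\sigma)]\le r\cdot\mathrm{cost}_{\mathrm{OPT}}(\sigma)+c$ for every finite task sequence $\sigma$. Theorem. There is a universal constant $C>0$ such that for every metric space $M$ on $n\ge 3$ points, every initial state, and every randomized online algorithm $A$ for the metrical task system on $M$: if $A$ is $r$-competitive against an oblivious adversary, then $$r\;\ge\; C\,\frac{\log n}{(\log\log n)^2}.$$ That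 is, the competitive ratio of every randomized online algorithm for the metrical task system on an $n$-point metric space is $\Omega(\log n/\log^2\log n)$. -/

import Mathlib

open MeasureTheory
open scoped ENNReal NNReal

namespace MTS

/-- A task assigns to every state a service cost in `[0, ∞]`. -/
abbrev Task (V : Type*) := V → ℝ≥0∞

/-- The cost of serving the task sequence `σ` along the trajectory `u`, where `u 0` is the starting
state and `u (i + 1)` is the state in which the `i`-th task (counted from `0`) is served: every
task costs the distance moved plus the service cost in the new state. -/
noncomputable def cost {V : Type*} [MetricSpace V] (σ : List (Task V)) (u : ℕ → V) : ℝ≥0∞ :=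
  ∑ i : Fin σ.length, (edist (u (i : ℕ)) (u ((i : ℕ) + 1)) + σ.get i (u ((i : ℕ) + 1)))

/-- The optimal offline cost of serving `σ` from the initial state `v₀`. -/
noncomputable def optCost {V : Type*} [MetricSpace V] (v₀ : V) (σ : List (Task V)) : ℝ≥0∞ :=
  ⨅ (u : ℕ → V) (_ : u 0 = v₀), cost σ u

/-- A randomized online algorithm with initial state `v₀` and random source `Ω`. After the tasks
`τ` have arrived (in this order) it is in the state `state τ ω`, which depends only on the tasks
seen so far and on the random outcome `ω`. -/
structure RandomizedAlgorithm (V : Type*) (v₀ : V) (Ω : Type*) [MeasurableSpace Ω] where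
  state : List (Task V) → Ω → V
  state_nil : ∀ ω, state [] ω = v₀
  measurableSet_state : ∀ (τ : List (Task V)) (v : V), MeasurableSet {ω | state τ ω = v}

/-- The expected cost of the algorithm on the task sequence `σ`. -/
noncomputable def RandomizedAlgorithm.expectedCost {V : Type*} [MetricSpace V] {v₀ : V}
    {Ω : Type*} [MeasurableSpace Ω] (A : RandomizedAlgorithm V v₀ Ω) (P : Measure Ω)
    (σ : List (Task V)) : ℝ≥0∞ :=
  ∫⁻ ω, cost σ (fun i => A.state (σ.take i) ω) ∂P

/-- `r`-competitiveness against an oblivious adversary: the task sequence is fixed independently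
of the random outcome, and the additive constant `c` does not depend on it. -/
def RandomizedAlgorithm.IsCompetitive {V : Type*} [MetricSpace V] {v₀ : V}
    {Ω : Type*} [MeasurableSpace Ω] (A : RandomizedAlgorithm V v₀ Ω) (P : Measure Ω)
    (r : ℝ≥0) : Prop :=
  ∃ c : ℝ≥0, ∀ σ : List (Task V), A.expectedCost P σ ≤ r * optCost v₀ σ + c

end MTS

/-! The argument gives the stronger bound of order `log n`; the squared double logarithm is only
thrown away at the end.

An adversary on a subset `A` at scale `D` is a random task sequence that costs any online algorithm
starting in `A` at least `D / 48` in expectation, when leaving `A` is charged `D / 16`, whereas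
independent repetitions can be served offline inside `A` at average cost `D / (48 * r)`. Tasks that
are infinite outside `A` trap the algorithm there, and many repetitions then force its competitive
ratio to be at least `r` (`HasRatio.le_of_isCompetitive`).

Adversaries are combined in stars. Let children have mutual distances between `D / 16` and `D`. In
each round every child is attacked with probability one half. Online, every starting child costs
half an attack (`star_online`). Offline, rounds are grouped into phases: the player sits in the
child of best ratio by default, and spends a phase elsewhere if another child happens to be attacked
unusually rarely (`star_offline`, `exists_side`). Deviations of fair coins then raise the best ratio
`r` to `r + c * min (log j) (j * exp (-C * δ))` when `j` children have ratios within `δ` of it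
(`exists_gain`). Optimising over `j` shows that the exponentials of the children's ratios, suitably
scaled, add up (`exists_hasRatio_star`). By induction a hierarchically separated set of size `s`
carries a ratio of order `log s`.

Finally a ball-cutting argument of metric Ramsey type finds such a set of size at least `√n` in
every `n`-point space (`exists_hierarchical_univ`), which costs only a factor two in the logarithm.
-/

namespace MTS

/-! ### Expectations over discrete distributions -/

section Expectation

variable {α β ι : Type*}

/-- The expectation of `f` under the discrete distribution `p`. -/
noncomputable def pexp (p : PMF α) (f : α → ℝ≥0∞) : ℝ≥0∞ := ∑' x, p x * f x

theorem pexp_mono (p : PMF α) {f g : α → ℝ≥0∞} (h : ∀ x, f x ≤ g x) : pexp p f ≤ pexp p g :=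
  ENNReal.tsum_le_tsum fun x => mul_le_mul_right (h x) _

theorem pexp_add (p : PMF α) (f g : α → ℝ≥0∞) :
    pexp p (fun x => f x + g x) = pexp p f + pexp p g := by
  simp only [pexp, mul_add, ENNReal.tsum_add]

theorem pexp_const (p : PMF α) (c : ℝ≥0∞) : pexp p (fun _ => c) = c := by
  simp only [pexp, ENNReal.tsum_mul_right, p.tsum_coe, one_mul]

theorem pexp_const_mul (p : PMF α) (c : ℝ≥0∞) (f : α → ℝ≥0∞) :
    pexp p (fun x => c * f x) = c * pexp p f := by
  simp only [pexp, mul_left_comm _ c, ENNReal.tsum_mul_left]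

theorem pexp_sum (p : PMF α) (s : Finset ι) (f : ι → α → ℝ≥0∞) :
    pexp p (fun x => ∑ i ∈ s, f i x) = ∑ i ∈ s, pexp p (f i) := by
  classical
  induction s using Finset.induction_on with
  | empty => simpa using pexp_const p 0
  | insert i s hi ih => simp only [Finset.sum_insert hi, pexp_add, ih]

theorem pexp_pure (a : α) (f : α → ℝ≥0∞) : pexp (PMF.pure a) f = f a := by
  classical
  rw [pexp, tsum_eq_single a]
  · simp
  · intro b hb
    simp [PMF.pure_apply, hb]

theorem pexp_bind (p : PMF α) (k : α → PMF β) (f : β → ℝ≥0∞) :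
    pexp (p.bind k) f = pexp p fun x => pexp (k x) f := by
  simp only [pexp, PMF.bind_apply, ← ENNReal.tsum_mul_right, ← ENNReal.tsum_mul_left]
  rw [ENNReal.tsum_comm]
  simp only [mul_assoc]

theorem pexp_map (p : PMF α) (k : α → β) (f : β → ℝ≥0∞) :
    pexp (p.map k) f = pexp p fun x => f (k x) := by
  rw [PMF.map, pexp_bind]
  simp only [Function.comp, pexp_pure]

theorem pexp_uniformOfFintype [Fintype α] [Nonempty α] (f : α → ℝ≥0∞) :
    pexp (PMF.uniformOfFintype α) f = (Fintype.card α : ℝ≥0∞)⁻¹ * ∑ x, f x := by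
  simp only [pexp, PMF.uniformOfFintype_apply, tsum_fintype, Finset.mul_sum]

end Expectation

/-! ### Concatenations of independent random lists -/

section Concat

variable {α β ι κ : Type*}

/-- The concatenation of independent samples of `V i`, where `i` runs through the list. -/
noncomputable def concat (V : ι → PMF (List α)) : List ι → PMF (List α)
  | [] => PMF.pure []
  | i :: l => (V i).bind fun τ => (concat V l).map (τ ++ ·)

/-- The concatenation of `n` independent samples of `p`. -/
noncomputable def iid (p : PMF (List α)) (n : ℕ) : PMF (List α) :=
  concat (fun _ : Unit => p) (List.replicate n ())

theorem concat_append (V : ι → PMF (List α)) (l l' : List ι) :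
    concat V (l ++ l') = (concat V l).bind fun σ => (concat V l').map (σ ++ ·) := by
  induction l with
  | nil =>
    simp only [List.nil_append, concat, PMF.pure_bind]
    exact (PMF.map_id _).symm
  | cons i l ih =>
    simp only [List.cons_append, concat, ih, PMF.bind_bind, PMF.bind_map, PMF.map_bind,
      PMF.map_comp, Function.comp_def, List.append_assoc]

theorem concat_flatMap (V : ι → PMF (List α)) (h : κ → List ι) (l : List κ) :
    concat V (l.flatMap h) = concat (fun k => concat V (h k)) l := by
  induction l with
  | nil => rfl
  | cons k l ih => rw [List.flatMap_cons, concat_append, ih, concat]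

theorem map_concat (V : ι → PMF (List α)) (φ : List α → List β) (h0 : φ [] = [])
    (happ : ∀ x y, φ (x ++ y) = φ x ++ φ y) (l : List ι) :
    (concat V l).map φ = concat (fun i => (V i).map φ) l := by
  induction l with
  | nil => simp only [concat, PMF.pure_map, h0]
  | cons i l ih =>
    simp only [concat, ← ih, PMF.map_bind, PMF.bind_map, PMF.map_comp, Function.comp_def, happ]

theorem iid_zero (p : PMF (List α)) : iid p 0 = PMF.pure [] := rfl

theorem iid_succ (p : PMF (List α)) (n : ℕ) :
    iid p (n + 1) = p.bind fun τ => (iid p n).map (τ ++ ·) := rfl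

theorem iid_add (p : PMF (List α)) (m n : ℕ) :
    iid p (m + n) = (iid p m).bind fun σ => (iid p n).map (σ ++ ·) := by
  rw [iid, List.replicate_add, concat_append]; rfl

theorem iid_mul (p : PMF (List α)) (m n : ℕ) : iid p (m * n) = iid (iid p m) n := by
  induction n with
  | zero => rfl
  | succ n ih => rw [Nat.mul_succ, Nat.add_comm, iid_add, ih, iid_succ]

/-- Independent copies of a random concatenation can be sampled by drawing all indices first. -/
theorem iid_bind_concat (U : PMF κ) (V : ι → PMF (List α)) (h : κ → List ι) (n : ℕ) :
    iid (U.bind fun c => concat V (h c)) n =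
      (iid (U.map fun c => [c]) n).bind fun cs => concat V (cs.flatMap h) := by
  induction n with
  | zero => simp [iid_zero, concat]
  | succ n ih =>
    simp only [iid_succ, ih, PMF.bind_bind, PMF.bind_map, PMF.map_bind, Function.comp_def,
      List.singleton_append, List.flatMap_cons, concat_append]
    congr 1
    funext c
    rw [PMF.bind_comm]

/-- Serves to recognise the tasks aimed at one child, filtered out of a list of attacks, as
independent copies of that child's adversary; `concat_ite_iid` does the same across phases. -/
theorem concat_ite_eq_iid [DecidableEq ι] (p : PMF (List α)) (j : ι) (l : List ι) :
    concat (fun i => if i = j then p else PMF.pure []) l = iid p (l.count j) := by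
  induction l with
  | nil => rfl
  | cons i l ih =>
    rw [concat, ih, List.count_cons]
    by_cases h : i = j
    · simp [h, iid_succ]
    · simp only [h, if_false, PMF.pure_bind, List.nil_append, beq_iff_eq, add_zero]
      exact PMF.map_id _

theorem concat_ite_iid (p : PMF (List α)) (Q : κ → Prop) [DecidablePred Q] (m : κ → ℕ)
    (l : List κ) :
    concat (fun k => if Q k then iid p (m k) else PMF.pure []) l =
      iid p (l.map fun k => if Q k then m k else 0).sum := by
  induction l with
  | nil => rfl
  | cons k l ih =>
    rw [concat, ih, List.map_cons, List.sum_cons, iid_add]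
    by_cases h : Q k
    · simp [h]
    · simp [h, iid_zero]

theorem pexp_iid_sum (U : PMF κ) (φ : κ → ℝ≥0∞) (n : ℕ) :
    pexp (iid (U.map fun c => [c]) n) (fun cs => (cs.map φ).sum) = n * pexp U φ := by
  induction n with
  | zero => simp [iid_zero, pexp_pure]
  | succ n ih =>
    simp only [iid_succ, pexp_bind, pexp_map, List.singleton_append, List.map_cons, List.sum_cons,
      pexp_add, pexp_const, ih]
    push_cast
    ring

end Concat

/-! ### Online cost charged inside a subset, and offline optimum. -/

section Costs

variable {V : Type*} [MetricSpace V]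

open Classical in
/-- The cost charged inside `A` for one step from `x` to `y` with task `t`: leaving `A` is charged
`γ`, and everything that starts outside `A` is free. -/
noncomputable def stepCost (A : Finset V) (γ : ℝ≥0∞) (x y : V) (t : Task V) : ℝ≥0∞ :=
  if x ∈ A then if y ∈ A then edist x y + t y else γ else 0

/-- The cost charged inside `A` to the deterministic online algorithm `g` on a task sequence. -/
noncomputable def localCost (A : Finset V) (γ : ℝ≥0∞) : List (Task V) → (List (Task V) → V) → ℝ≥0∞
  | [], _ => 0
  | t :: σ, g => stepCost A γ (g []) (g [t]) t + localCost A γ σ fun τ => g (t :: τ)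

/-- The offline cost of serving a task sequence inside `A`, starting at a given point. -/
noncomputable def opt (A : Finset V) : List (Task V) → V → ℝ≥0∞
  | [], _ => 0
  | t :: σ, u => ⨅ v ∈ A, (edist u v + t v + opt A σ v)

open Classical in
/-- The task that agrees with `t` on `A` and is free elsewhere. -/
noncomputable def mask (A : Finset V) (t : Task V) : Task V := fun v => if v ∈ A then t v else 0

theorem localCost_append (A : Finset V) (γ : ℝ≥0∞) (σ τ : List (Task V))
    (g : List (Task V) → V) :
    localCost A γ (σ ++ τ) g = localCost A γ σ g + localCost A γ τ fun ρ => g (σ ++ ρ) := by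
  induction σ generalizing g with
  | nil => simp [localCost]
  | cons t σ ih => simp only [List.cons_append, localCost, ih, add_assoc]

theorem stepCost_mono {A : Finset V} {γ γ' : ℝ≥0∞} (h : γ ≤ γ') (x y : V) (t : Task V) :
    stepCost A γ x y t ≤ stepCost A γ' x y t := by
  unfold stepCost; split_ifs <;> first | exact h | exact le_rfl

theorem localCost_mono {A : Finset V} {γ γ' : ℝ≥0∞} (h : γ ≤ γ') (σ : List (Task V))
    (g : List (Task V) → V) : localCost A γ σ g ≤ localCost A γ' σ g := by
  induction σ generalizing g with
  | nil => exact le_rfl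
  | cons t σ ih => exact add_le_add (stepCost_mono h _ _ _) (ih _)

open Classical in
/-- Raising the exit charge by `c` is felt by every trajectory that ends outside. -/
theorem localCost_add_le {A : Finset V} (γ c : ℝ≥0∞) (σ : List (Task V))
    (g : List (Task V) → V) (hg : g [] ∈ A) :
    localCost A γ σ g + (if g σ ∈ A then 0 else c) ≤ localCost A (γ + c) σ g := by
  induction σ generalizing g with
  | nil => simp [localCost, hg]
  | cons t σ ih =>
    by_cases h : g [t] ∈ A
    · have := ih (fun τ => g (t :: τ)) h
      simp only [localCost]
      rw [add_assoc]
      refine add_le_add ?_ this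
      simp [stepCost, hg, h]
    · have h1 : localCost A γ σ (fun τ => g (t :: τ)) ≤
          localCost A (γ + c) σ (fun τ => g (t :: τ)) := localCost_mono le_self_add _ _
      simp only [localCost, stepCost, hg, h, if_true, if_false]
      rw [add_right_comm]
      refine add_le_add (add_le_add le_rfl ?_) h1
      split_ifs <;> simp

theorem le_localCost_of_exit {A : Finset V} (γ : ℝ≥0∞) (σ : List (Task V))
    (g : List (Task V) → V) (hg : g [] ∈ A) (hσ : g σ ∉ A) : γ ≤ localCost A γ σ g := by
  have := localCost_add_le 0 γ σ g hg
  simp only [hσ, if_false, zero_add] at this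
  exact le_add_self.trans this

/-- A move from `A` to the rest of `X` is charged its distance, hence at least `γ`, on the right,
and an exit from `X` is charged `γ` on both sides. So the cost in a union is bounded below by that
in the child where the algorithm starts. -/
theorem localCost_subset {A X : Finset V} {γ : ℝ≥0∞} (hAX : A ⊆ X)
    (hd : ∀ x ∈ A, ∀ y ∈ X, y ∉ A → γ ≤ edist x y) (σ : List (Task V))
    (g : List (Task V) → V) : localCost A γ σ g ≤ localCost X γ σ g := by
  induction σ generalizing g with
  | nil => exact le_rfl
  | cons t σ ih =>
    refine add_le_add ?_ (ih _)
    unfold stepCost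
    by_cases hx : g [] ∈ A
    · by_cases hy : g [t] ∈ A
      · simp [hx, hy, hAX hx, hAX hy]
      · by_cases hy' : g [t] ∈ X
        · simp only [hx, hy, hy', hAX hx, if_true, if_false]
          exact (hd _ hx _ hy' hy).trans le_self_add
        · simp [hx, hy, hy', hAX hx]
    · simp [hx]

theorem localCost_map_mask (A : Finset V) (γ : ℝ≥0∞) (σ : List (Task V))
    (g : List (Task V) → V) :
    localCost A γ (σ.map (mask A)) g = localCost A γ σ fun τ => g (τ.map (mask A)) := by
  induction σ generalizing g with
  | nil => rfl
  | cons t σ ih =>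
    simp only [List.map_cons, localCost, ih, List.map_nil]
    congr 1
    unfold stepCost mask
    split_ifs <;> simp_all

theorem opt_le_opt_append (A : Finset V) (σ τ : List (Task V)) (u : V) :
    opt A σ u ≤ opt A (σ ++ τ) u := by
  induction σ generalizing u with
  | nil => exact zero_le
  | cons t σ ih => exact iInf₂_mono fun v _ => add_le_add le_rfl (ih v)

theorem opt_le_edist_add (A : Finset V) (σ : List (Task V)) (u v : V) :
    opt A σ u ≤ edist u v + opt A σ v := by
  cases σ with
  | nil => exact zero_le
  | cons t σ =>
    simp only [opt, ENNReal.add_iInf]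
    refine iInf₂_mono fun w _ => ?_
    rw [← add_assoc, ← add_assoc]
    gcongr
    exact edist_triangle _ _ _

end Costs

/-! ### Random adversaries and their repetition. -/

section Adversary

variable {V : Type*} [MetricSpace V]

/-- A random task sequence `p` that costs every online algorithm starting in `A` at least `a` in
expectation, when leaving `A` is charged `γ`, while independent repetitions of `p` can be served
offline inside `A` at an average cost of `o`. -/
structure IsAdversary (A : Finset V) (p : PMF (List (Task V))) (a γ o : ℝ≥0∞) : Prop where
  online : ∀ g : List (Task V) → V, g [] ∈ A → a ≤ pexp p fun σ => localCost A γ σ g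
  offline : ∃ c : ℝ≥0∞, c ≠ ∞ ∧ ∀ (T : ℕ), ∀ u ∈ A,
    pexp (iid p T) (fun σ => opt A σ u) ≤ T * o + c

theorem IsAdversary.mono {A : Finset V} {p : PMF (List (Task V))} {a γ o γ' o' : ℝ≥0∞}
    (h : IsAdversary A p a γ o) (hγ : γ ≤ γ') (ho : o ≤ o') : IsAdversary A p a γ' o' := by
  refine ⟨fun g hg => (h.online g hg).trans (pexp_mono _ fun σ => localCost_mono hγ _ _), ?_⟩
  obtain ⟨c, hc, H⟩ := h.offline
  exact ⟨c, hc, fun T u hu => (H T u hu).trans (by gcongr)⟩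

-- Staying and leaving both cost `a`, and offline pays `a` as well: ratio one, the base of the
-- hierarchy.
open Classical in
theorem isAdversary_singleton (v : V) (a : ℝ≥0∞) :
    IsAdversary {v} (PMF.pure [fun w => if w = v then a else 0]) a a a := by
  constructor
  · intro g hg
    rw [Finset.mem_singleton] at hg
    rw [pexp_pure]
    simp only [localCost, stepCost, hg, Finset.mem_singleton, if_true, add_zero]
    split_ifs with h
    · exact le_add_self
    · exact le_rfl
  · refine ⟨0, ENNReal.zero_ne_top, fun T u hu => ?_⟩
    rw [Finset.mem_singleton] at hu
    subst hu
    rw [add_zero]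
    induction T with
    | zero => simp [iid_zero, pexp_pure, opt]
    | succ T ih =>
      rw [iid_succ, PMF.pure_bind, pexp_map]
      calc _ ≤ pexp (iid (PMF.pure [fun w => if w = u then a else 0]) T)
            (fun σ => a + opt {u} σ u) := by
            refine pexp_mono _ fun σ => ?_
            simp [opt]
        _ ≤ a + T * a := by rw [pexp_add, pexp_const]; gcongr
        _ = _ := by push_cast; ring

/-- An algorithm outside `A` pays nothing more, so the exit charge has to prepay all remaining
copies; this is the extra `N * a`. -/
theorem IsAdversary.iid {A : Finset V} {p : PMF (List (Task V))} {a γ o : ℝ≥0∞}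
    (h : IsAdversary A p a γ o) (N : ℕ) :
    IsAdversary A (iid p N) (N * a) (γ + N * a) (N * o) := by
  classical
  constructor
  · induction N with
    | zero => intro g hg; simp
    | succ N ih =>
      intro g hg
      rw [iid_succ, pexp_bind]
      have key : ∀ τ, localCost A γ τ g + N * a ≤ pexp ((MTS.iid p N).map (τ ++ ·)) fun σ =>
          localCost A (γ + (N + 1 : ℕ) * a) σ g := by
        intro τ
        simp only [pexp_map, localCost_append]
        rw [pexp_add, pexp_const]
        have h1 : localCost A γ τ g + (if g τ ∈ A then 0 else N * a) ≤
            localCost A (γ + (N + 1 : ℕ) * a) τ g := by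
          refine (localCost_add_le _ _ _ _ hg).trans (localCost_mono ?_ _ _)
          gcongr; simp
        by_cases hτ : g τ ∈ A
        · simp only [hτ, if_true, add_zero] at h1
          refine add_le_add h1 ((ih (fun ρ => g (τ ++ ρ)) (by simpa using hτ)).trans ?_)
          refine pexp_mono _ fun σ => localCost_mono ?_ _ _
          gcongr; simp
        · simp only [hτ, if_false] at h1
          exact h1.trans le_self_add
      calc ((N + 1 : ℕ) : ℝ≥0∞) * a = a + N * a := by push_cast; ring
        _ ≤ pexp p (fun τ => localCost A γ τ g + N * a) := by
            rw [pexp_add, pexp_const]; gcongr; exact h.online g hg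
        _ ≤ _ := pexp_mono _ key
  · obtain ⟨c, hc, H⟩ := h.offline
    refine ⟨c, hc, fun T u hu => ?_⟩
    rw [← iid_mul]
    refine (H _ u hu).trans (le_of_eq ?_)
    push_cast
    ring

/-- It suffices to bound the offline cost along multiples of a fixed number of repetitions. -/
theorem offline_of_phases {A : Finset V} {p : PMF (List (Task V))} {o c : ℝ≥0∞} (ho : o ≠ ∞)
    (hc : c ≠ ∞) {n : ℕ} (hn : 0 < n) (H : ∀ (K : ℕ), ∀ u ∈ A,
      pexp (MTS.iid (MTS.iid p n) K) (fun σ => opt A σ u) ≤ K * (n * o) + c) :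
    ∃ c : ℝ≥0∞, c ≠ ∞ ∧ ∀ (T : ℕ), ∀ u ∈ A,
      pexp (MTS.iid p T) (fun σ => opt A σ u) ≤ T * o + c := by
  -- `T` is rounded up to whole phases; the surplus phase goes into the additive constant.
  refine ⟨n * o + c, by finiteness, fun T u hu => ?_⟩
  have hT : T ≤ n * (T / n + 1) := (Nat.lt_mul_div_succ T hn).le
  obtain ⟨S, hS⟩ := Nat.exists_eq_add_of_le hT
  calc pexp (MTS.iid p T) (fun σ => opt A σ u)
      ≤ pexp (MTS.iid p (T + S)) (fun σ => opt A σ u) := by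
        rw [iid_add, pexp_bind]
        refine pexp_mono _ fun σ => ?_
        rw [pexp_map]
        calc _ = pexp (MTS.iid p S) (fun _ => opt A σ u) := (pexp_const _ _).symm
          _ ≤ _ := pexp_mono _ fun τ => opt_le_opt_append _ _ _ _
    _ ≤ (T / n + 1 : ℕ) * (n * o) + c := by rw [← hS, iid_mul]; exact H _ u hu
    _ ≤ _ := by
        have : ((T / n * n : ℕ) : ℝ≥0∞) ≤ T := by exact_mod_cast Nat.div_mul_le_self T n
        calc ((T / n + 1 : ℕ) : ℝ≥0∞) * (n * o) + c
            = ((T / n * n : ℕ) : ℝ≥0∞) * o + (n * o + c) := by push_cast; ring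
          _ ≤ _ := by gcongr

end Adversary

set_option linter.unusedSectionVars false

/-! ### The star adversary: attacking children by coin flips. -/

section Star

variable {V : Type*} [MetricSpace V] {ι : Type*} [Fintype ι] [DecidableEq ι]

/-- The children selected by a coin. -/
noncomputable def hits (c : ι → Bool) : List ι := (Finset.univ.filter fun i => c i = true).toList

theorem mem_hits {c : ι → Bool} {i : ι} : i ∈ hits c ↔ c i = true := by simp [hits]

theorem count_flatMap_hits (cs : List (ι → Bool)) (i : ι) :
    (cs.flatMap hits).count i = cs.countP fun c => c i := by
  induction cs with
  | nil => rfl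
  | cons c cs ih =>
    rw [List.flatMap_cons, List.count_append, ih, List.countP_cons, Nat.add_comm]
    congr 1
    have hn : (hits c).Nodup := Finset.nodup_toList _
    by_cases h : c i = true
    · simp [h, List.count_eq_one_of_mem hn (mem_hits.2 h)]
    · simp [h, List.count_eq_zero_of_not_mem (mt mem_hits.1 h)]

/-- The adversary that flips a fair coin for every child `A i` and attacks in turn, with `p i`,
the children that were selected. -/
noncomputable def star (A : ι → Finset V) (p : ι → PMF (List (Task V))) : PMF (List (Task V)) :=
  (PMF.uniformOfFintype (ι → Bool)).bind fun c =>
    concat (fun i => (p i).map (List.map (mask (A i)))) (hits c)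

theorem sum_bool_fun_ite (i : ι) (a : ℝ≥0∞) :
    (Fintype.card (ι → Bool) : ℝ≥0∞)⁻¹ * ∑ c : ι → Bool, (if c i = true then a else 0) = a / 2 := by
  have h1 : ∑ c : ι → Bool, (if c i = true then a else 0) =
      ∑ c : ι → Bool, (if c i = true then 0 else a) := by
    refine Fintype.sum_equiv (Equiv.piCongrRight fun _ => Equiv.boolNot) _ _ fun c => ?_
    cases h : c i <;> simp [h]
  have h2 : 2 * ∑ c : ι → Bool, (if c i = true then a else 0) = Fintype.card (ι → Bool) * a := by
    rw [two_mul]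
    nth_rewrite 2 [h1]
    rw [← Finset.sum_add_distrib]
    have : ∀ c : ι → Bool, ((if c i = true then a else 0) + if c i = true then 0 else a) = a := by
      intro c; split_ifs <;> simp
    simp [this]
  set S := ∑ c : ι → Bool, (if c i = true then a else 0)
  have hcard : (Fintype.card (ι → Bool) : ℝ≥0∞) ≠ 0 := by simp
  have hcard' : (Fintype.card (ι → Bool) : ℝ≥0∞) ≠ ∞ := ENNReal.natCast_ne_top _
  rw [ENNReal.eq_div_iff two_ne_zero ENNReal.ofNat_ne_top, mul_left_comm, h2, ← mul_assoc,
    ENNReal.inv_mul_cancel hcard hcard', one_mul]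

/-- When the turn of `i` comes, the algorithm either has left `A i`, for a charge of at least `a`,
or is there and gets attacked. As `l` is fixed before `g`, knowing the coins would not help. -/
theorem le_pexp_concat_of_mem {A : ι → Finset V} {p : ι → PMF (List (Task V))} {a γ : ℝ≥0∞}
    (haγ : a ≤ γ) {i : ι}
    (hp : ∀ g : List (Task V) → V, g [] ∈ A i → a ≤ pexp (p i) fun σ => localCost (A i) γ σ g)
    (l : List ι) (hi : i ∈ l) (g : List (Task V) → V) (hg : g [] ∈ A i) :
    a ≤ pexp (concat p l) fun σ => localCost (A i) γ σ g := by
  classical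
  induction l generalizing g with
  | nil => simp at hi
  | cons j l ih =>
    simp only [concat, pexp_bind, pexp_map, localCost_append, pexp_add, pexp_const]
    by_cases hj : j = i
    · subst hj
      exact (hp g hg).trans le_self_add
    · have hil : i ∈ l := (List.mem_cons.1 hi).resolve_left (Ne.symm hj)
      rw [← pexp_add, ← pexp_const (p j) a]
      refine pexp_mono _ fun τ => ?_
      by_cases hτ : g τ ∈ A i
      · exact (ih hil (fun ρ => g (τ ++ ρ)) (by simpa using hτ)).trans le_add_self
      · exact (haγ.trans (le_localCost_of_exit γ τ g hg hτ)).trans le_self_add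

/-- Only the child of the starting point matters: its coin selects it with probability one half, and
then `a` is paid whatever the other coins show. -/
theorem star_online {A : ι → Finset V} {p : ι → PMF (List (Task V))} {X : Finset V}
    (hX : ∀ x, x ∈ X ↔ ∃ i, x ∈ A i) {a γ : ℝ≥0∞} (haγ : a ≤ γ)
    (hp : ∀ i, ∀ g : List (Task V) → V, g [] ∈ A i →
      a ≤ pexp (p i) fun σ => localCost (A i) γ σ g)
    (hsep : ∀ i j, i ≠ j → ∀ x ∈ A i, ∀ y ∈ A j, γ ≤ edist x y)
    (g : List (Task V) → V) (hg : g [] ∈ X) :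
    a / 2 ≤ pexp (star A p) fun σ => localCost X γ σ g := by
  classical
  obtain ⟨i, hi⟩ := (hX _).1 hg
  rw [star, pexp_bind, pexp_uniformOfFintype, ← sum_bool_fun_ite i a]
  gcongr with c
  split_ifs with hc
  · have hm : ∀ g : List (Task V) → V, g [] ∈ A i → a ≤
        pexp ((p i).map (List.map (mask (A i)))) fun σ => localCost (A i) γ σ g := by
      intro g hg
      simp only [pexp_map, localCost_map_mask]
      exact hp i _ (by simpa using hg)
    refine (le_pexp_concat_of_mem (p := fun i => (p i).map (List.map (mask (A i)))) haγ hm _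
      (mem_hits.2 hc) g hi).trans (pexp_mono _ fun σ => ?_)
    refine localCost_subset (fun x hx => (hX x).2 ⟨i, hx⟩) (fun x hx y hy hyA => ?_) σ g
    obtain ⟨j, hj⟩ := (hX y).1 hy
    exact hsep i j (fun h => hyA (h ▸ hj)) x hx y hj
  · exact zero_le

/-! #### Offline play against the star adversary -/

/-- The tasks of a list of attacks, tagged with the attacked child. -/
noncomputable def taggedTasks (A : ι → Finset V) (l : List (ι × Task V)) : List (Task V) :=
  l.map fun x => mask (A x.1) x.2

/-- The tasks in a tagged list that attack the child `j`. -/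
noncomputable def tasksAt (j : ι) (l : List (ι × Task V)) : List (Task V) :=
  (l.filter fun x => x.1 = j).map Prod.snd

/-- Staying in one child costs only the attacks on this child. -/
theorem opt_taggedTasks_append_le {A : ι → Finset V} {X : Finset V}
    (hX : ∀ i, A i ⊆ X) (hdisj : ∀ i j, i ≠ j → Disjoint (A i) (A j)) (i : ι)
    (rest sel : List (Task V)) (Q : ℝ≥0∞)
    (h : ∀ v ∈ A i, opt X rest v ≤ Q + opt (A i) sel v) (l : List (ι × Task V)) :
    ∀ v ∈ A i, opt X (taggedTasks A l ++ rest) v ≤ Q + opt (A i) (tasksAt i l ++ sel) v := by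
  induction l with
  | nil => simpa [taggedTasks, tasksAt] using h
  | cons x l ih =>
    intro v hv
    obtain ⟨k, t⟩ := x
    by_cases hk : k = i
    · subst hk
      have e1 : taggedTasks A ((k, t) :: l) = mask (A k) t :: taggedTasks A l := rfl
      have e2 : tasksAt k ((k, t) :: l) = t :: tasksAt k l := by simp [tasksAt]
      rw [e1, e2]
      simp only [List.cons_append, opt, ENNReal.add_iInf]
      refine le_iInf₂ fun w hw => (iInf₂_le w (hX k hw)).trans ?_
      calc _ ≤ edist v w + t w + (Q + opt (A k) (tasksAt k l ++ sel) w) := by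
            gcongr
            · simp [mask, hw]
            · exact ih w hw
        _ = _ := by ring
    · have e1 : taggedTasks A ((k, t) :: l) = mask (A k) t :: taggedTasks A l := rfl
      have e2 : tasksAt i ((k, t) :: l) = tasksAt i l := by simp [tasksAt, hk]
      rw [e1, e2, List.cons_append]
      refine (iInf₂_le v (hX i hv)).trans ?_
      have hvk : v ∉ A k := fun hvk => Finset.disjoint_left.1 (hdisj k i hk) hvk hv
      simp only [mask, hvk, if_false, edist_self, zero_add, add_zero]
      exact ih v hv

/-- The tasks on which the offline player spends anything when it stays in the child `q.1` during
the phase `q`. -/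
noncomputable def selectedTasks (j : ι) (ps : List (ι × List (ι × Task V))) :
    List (Task V) :=
  ps.flatMap fun q => if q.1 = j then tasksAt j q.2 else []

/-- The offline player may stay in one child during every phase and return to the child `i₀`
afterwards, resuming in every child where it left off. -/
theorem opt_phases_le {A : ι → Finset V} {X : Finset V}
    (hX : ∀ i, A i ⊆ X) (hdisj : ∀ i j, i ≠ j → Disjoint (A i) (A j)) (i₀ : ι) {D : ℝ≥0∞}
    (hD : ∀ i, i ≠ i₀ → ∀ x ∈ A i, ∀ y ∈ A i₀, edist x y ≤ D)
    (ps : List (ι × List (ι × Task V))) :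
    ∀ u : ι → V, (∀ i, u i ∈ A i) →
    opt X (ps.flatMap fun q => taggedTasks A q.2) (u i₀) ≤
      (ps.map fun q => if q.1 = i₀ then 0 else 2 * D).sum +
        ∑ j, opt (A j) (selectedTasks j ps) (u j) := by
  induction ps with
  | nil => intro u hu; simp [opt]
  | cons q ps ih =>
    intro u hu
    obtain ⟨i, l⟩ := q
    set M := (ps.map fun q => if q.1 = i₀ then 0 else 2 * D).sum with hM
    set E : ℝ≥0∞ := if i = i₀ then 0 else D with hE
    have hmove : ∀ v ∈ A i, ∀ w ∈ A i₀, i ≠ i₀ → edist v w ≤ E := by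
      intro v hv w hw hi
      simpa [hE, hi] using hD i hi v hv w hw
    have hback : ∀ v ∈ A i, opt X (ps.flatMap fun q => taggedTasks A q.2) v ≤
        (E + M + ∑ j ∈ Finset.univ.erase i, opt (A j) (selectedTasks j ps) (u j)) +
          opt (A i) (selectedTasks i ps) v := by
      intro v hv
      have hu' : ∀ j, Function.update u i v j ∈ A j := by
        intro j
        by_cases hj : j = i
        · subst hj; simpa using hv
        · simpa [hj] using hu j
      -- `u j` is where play in child `j` resumes. A phase spent in `i` changes only that entry, to
      -- the point `v` where the phase ends.
      have h1 := ih (Function.update u i v) hu'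
      have h2 : ∑ j, opt (A j) (selectedTasks j ps) (Function.update u i v j) =
          ∑ j ∈ Finset.univ.erase i, opt (A j) (selectedTasks j ps) (u j) +
            opt (A i) (selectedTasks i ps) v := by
        rw [← Finset.sum_erase_add _ _ (Finset.mem_univ i)]
        congr 1
        · refine Finset.sum_congr rfl fun j hj => ?_
          rw [Function.update_of_ne (Finset.ne_of_mem_erase hj)]
        · rw [Function.update_self]
      rw [h2] at h1
      have h3 : opt X (ps.flatMap fun q => taggedTasks A q.2) v ≤
          E + opt X (ps.flatMap fun q => taggedTasks A q.2) (Function.update u i v i₀) := by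
        by_cases hi : i = i₀
        · subst hi; simp
        · refine (opt_le_edist_add X _ v (Function.update u i v i₀)).trans ?_
          gcongr
          exact hmove v hv _ (hu' i₀) hi
      calc _ ≤ _ := h3
        _ ≤ E + _ := add_le_add le_rfl h1
        _ = _ := by ring
    have hphase := opt_taggedTasks_append_le hX hdisj i _ _ _ hback l (u i) (hu i)
    have hgo : opt X (((i, l) :: ps).flatMap fun q => taggedTasks A q.2) (u i₀) ≤
        E + opt X (taggedTasks A l ++ ps.flatMap fun q => taggedTasks A q.2) (u i) := by
      rw [List.flatMap_cons]
      by_cases hi : i = i₀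
      · subst hi; simp
      · refine (opt_le_edist_add X _ _ (u i)).trans ?_
        gcongr
        rw [edist_comm]
        exact hmove _ (hu i) _ (hu i₀) hi
    have hsum : ∑ j, opt (A j) (selectedTasks j ((i, l) :: ps)) (u j) =
        ∑ j ∈ Finset.univ.erase i, opt (A j) (selectedTasks j ps) (u j) +
          opt (A i) (tasksAt i l ++ selectedTasks i ps) (u i) := by
      rw [← Finset.sum_erase_add _ _ (Finset.mem_univ i)]
      congr 1
      · refine Finset.sum_congr rfl fun j hj => ?_
        simp [selectedTasks, (Finset.ne_of_mem_erase hj).symm]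
      · simp [selectedTasks]
    have hEE : (if i = i₀ then 0 else 2 * D) = E + E := by
      rw [hE]; split_ifs <;> simp [two_mul]
    rw [hsum, List.map_cons, List.sum_cons, hEE]
    calc _ ≤ _ := hgo
      _ ≤ E + _ := add_le_add le_rfl hphase
      _ = _ := by ring

/-- The random phases in which the coins are `γ` and the offline player stays in `side γ`. -/
noncomputable def phase {Γ : Type*} (p : ι → PMF (List (Task V))) (h : Γ → List ι)
    (side : Γ → ι) (c : Γ) : PMF (List (ι × List (ι × Task V))) :=
  (concat (fun i => (p i).map (List.map fun t => (i, t))) (h c)).map fun l => [(side c, l)]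

theorem map_phase_tasks {Γ : Type*} (A : ι → Finset V) (p : ι → PMF (List (Task V)))
    (h : Γ → List ι) (side : Γ → ι) (cs : List Γ) :
    (concat (phase p h side) cs).map (fun ps => ps.flatMap fun q => taggedTasks A q.2) =
      concat (fun i => (p i).map (List.map (mask (A i)))) (cs.flatMap h) := by
  rw [map_concat _ _ rfl (fun x y => List.flatMap_append), concat_flatMap]
  congr 1
  funext c
  rw [phase, PMF.map_comp]
  simp only [Function.comp_def, List.flatMap_cons, List.flatMap_nil, List.append_nil]
  rw [map_concat _ _ rfl (fun x y => by simp [taggedTasks])]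
  congr 1
  funext i
  rw [PMF.map_comp]
  simp [taggedTasks, Function.comp_def]

/-- `side` reads the coins only, never the tasks. Given the coins, the attacks that hit the offline
player in `j` are therefore still independent copies of `p j`, so the offline bound for `p j`
applies to them. -/
theorem map_phase_selectedTasks {Γ : Type*} (p : ι → PMF (List (Task V)))
    (h : Γ → List ι) (side : Γ → ι) (cs : List Γ) (j : ι) :
    (concat (phase p h side) cs).map (selectedTasks j) =
      iid (p j) (cs.map fun c => if side c = j then (h c).count j else 0).sum := by
  rw [map_concat _ (selectedTasks j) rfl (fun x y => List.flatMap_append), ← concat_ite_iid]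
  congr 1
  funext c
  rw [phase, PMF.map_comp]
  simp only [Function.comp_def, selectedTasks, List.flatMap_cons, List.flatMap_nil,
    List.append_nil]
  split_ifs with hc
  · rw [map_concat _ (tasksAt j) rfl (fun x y => by simp [tasksAt]), ← concat_ite_eq_iid]
    congr 1
    funext i
    rw [PMF.map_comp]
    split_ifs with hi
    · subst hi
      have : (tasksAt i ∘ List.map fun t : Task V => (i, t)) = id := by
        funext l; simp [tasksAt, List.filter_map, Function.comp_def]
      rw [this, PMF.map_id]
    · have : (tasksAt j ∘ List.map fun t : Task V => (i, t)) = fun _ => [] := by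
        funext l; simp [tasksAt, List.filter_map, Function.comp_def, hi]
      rw [this]
      exact PMF.map_const _ _
  · exact PMF.map_const _ _

theorem sum_map_ite_natCast {Γ : Type*} (o : ι → ℝ≥0∞) (m : Γ → ι → ℕ)
    (side : Γ → ι) (cs : List Γ) :
    ∑ j, (((cs.map fun c => if side c = j then m c j else 0).sum : ℕ) : ℝ≥0∞) * o j =
      (cs.map fun c => (m c (side c) : ℝ≥0∞) * o (side c)).sum := by
  induction cs with
  | nil => simp
  | cons c cs ih =>
    simp only [List.map_cons, List.sum_cons, Nat.cast_add, add_mul, Finset.sum_add_distrib, ih]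
    congr 1
    rw [Finset.sum_eq_single (side c)] <;> simp +contextual [eq_comm]

/-- The offline cost of the star adversary when the player stays in the child `side cs` during a
phase of `n` rounds with coins `cs`, and moves only between this child and `i₀`. -/
theorem star_offline {A : ι → Finset V} {p : ι → PMF (List (Task V))}
    {X : Finset V} (hX : ∀ x, x ∈ X ↔ ∃ i, x ∈ A i) (hne : ∀ i, (A i).Nonempty)
    (hdisj : ∀ i j, i ≠ j → Disjoint (A i) (A j)) (i₀ : ι) {D ρ : ℝ≥0∞} (hρ : ρ ≠ ∞)
    (hD : ∀ i, i ≠ i₀ → ∀ x ∈ A i, ∀ y ∈ A i₀, edist x y ≤ D) {o : ι → ℝ≥0∞}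
    (hp : ∀ i, ∃ c : ℝ≥0∞, c ≠ ∞ ∧ ∀ (T : ℕ), ∀ u ∈ A i,
      pexp (iid (p i) T) (fun σ => opt (A i) σ u) ≤ T * o i + c)
    {n : ℕ} (hn : 0 < n) (side : List (ι → Bool) → ι)
    (hside : pexp (iid ((PMF.uniformOfFintype (ι → Bool)).map fun c => [c]) n) (fun cs =>
      (if side cs = i₀ then 0 else 2 * D) + cs.countP (fun c => c (side cs)) * o (side cs)) ≤
        n * ρ) :
    ∃ c : ℝ≥0∞, c ≠ ∞ ∧ ∀ (T : ℕ), ∀ u ∈ X,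
      pexp (iid (star A p) T) (fun σ => opt X σ u) ≤ T * ρ + c := by
  choose c hc hpc using hp
  choose u hu using hne
  refine offline_of_phases (c := ∑ v ∈ X, edist v (u i₀) + ∑ j, c j) hρ ?_ hn fun K v hv => ?_
  · refine ENNReal.add_ne_top.2 ⟨?_, ?_⟩
    · exact ENNReal.sum_ne_top.2 fun v _ => edist_ne_top _ _
    · exact ENNReal.sum_ne_top.2 fun j _ => hc j
  rw [star, iid_bind_concat, iid_bind_concat, pexp_bind]
  set U := iid ((PMF.uniformOfFintype (ι → Bool)).map fun c => [c]) n
  have key : ∀ γs : List (List (ι → Bool)),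
      pexp (concat (fun i => (p i).map (List.map (mask (A i))))
        (γs.flatMap fun cs => cs.flatMap hits)) (fun σ => opt X σ v) ≤
      (∑ v ∈ X, edist v (u i₀) + ∑ j, c j) + (γs.map fun cs =>
        (if side cs = i₀ then 0 else 2 * D) +
          cs.countP (fun c => c (side cs)) * o (side cs)).sum := by
    intro γs
    rw [← map_phase_tasks A p (fun cs => cs.flatMap hits) side, pexp_map]
    have hstart : edist v (u i₀) ≤ ∑ v ∈ X, edist v (u i₀) :=
      Finset.single_le_sum (f := fun v => edist v (u i₀)) (fun _ _ => zero_le) hv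
    have hsub : ∀ i, A i ⊆ X := fun i x hx => (hX x).2 ⟨i, hx⟩
    have hsel : ∀ j, pexp (concat (phase p (fun cs => cs.flatMap hits) side) γs)
        (fun ps => opt (A j) (selectedTasks j ps) (u j)) ≤
        ((γs.map fun cs => if side cs = j then (cs.flatMap hits).count j else 0).sum : ℕ) * o j
          + c j := by
      intro j
      have := hpc j (γs.map fun cs => if side cs = j then (cs.flatMap hits).count j else 0).sum
        (u j) (hu j)
      rw [← map_phase_selectedTasks p (fun cs => cs.flatMap hits) side γs j, pexp_map] at this
      exact this
    have hmoves : pexp (concat (phase p (fun cs => cs.flatMap hits) side) γs)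
        (fun ps => (ps.map fun q => if q.1 = i₀ then 0 else 2 * D).sum) =
        (γs.map fun cs => if side cs = i₀ then 0 else 2 * D).sum := by
      clear hsel
      induction γs with
      | nil => simp [concat, pexp_pure]
      | cons cs γs ih =>
        simp only [concat, pexp_bind, pexp_map, List.map_append, List.sum_append, pexp_add,
          pexp_const, ih]
        simp only [phase, pexp_map, List.map_cons, List.map_nil, List.sum_cons, List.sum_nil,
          add_zero]
        by_cases hs : side cs = i₀ <;> simp [hs, pexp_const]
    calc _ ≤ pexp (concat (phase p (fun cs => cs.flatMap hits) side) γs) (fun ps =>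
          ∑ v ∈ X, edist v (u i₀) + ((ps.map fun q => if q.1 = i₀ then 0 else 2 * D).sum +
            ∑ j, opt (A j) (selectedTasks j ps) (u j))) := by
          refine pexp_mono _ fun ps => (opt_le_edist_add X _ v (u i₀)).trans ?_
          exact add_le_add hstart (opt_phases_le hsub hdisj i₀ hD ps u hu)
      _ ≤ ∑ v ∈ X, edist v (u i₀) + ((γs.map fun cs => if side cs = i₀ then 0 else 2 * D).sum +
            ∑ j, (((γs.map fun cs => if side cs = j then (cs.flatMap hits).count j else 0).sum : ℕ)
              * o j + c j)) := by
          rw [pexp_add, pexp_const, pexp_add, hmoves, pexp_sum]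
          gcongr with j
          exact hsel j
      _ = _ := by
          have h := sum_map_ite_natCast o (fun cs j => (cs.flatMap hits).count j) side γs
          beta_reduce at h
          rw [Finset.sum_add_distrib, h]
          simp only [count_flatMap_hits, List.sum_map_add]
          ring
  calc _ ≤ _ := pexp_mono _ key
    _ ≤ _ := by
      rw [pexp_add, pexp_const, pexp_iid_sum, add_comm]
      gcongr

end Star

/-! ### Random words -/

/-- The number of ones in a word. -/
def weight {n : ℕ} (w : Fin n → Bool) : ℕ := ∑ t, if w t = true then 1 else 0

theorem weight_not_add {n : ℕ} (w : Fin n → Bool) : weight w + weight (fun t => !w t) = n := by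
  unfold weight
  rw [← Finset.sum_add_distrib]
  calc _ = ∑ _t : Fin n, 1 := Finset.sum_congr rfl fun t _ => by cases h : w t <;> simp [h]
    _ = n := by simp

theorem countP_ofFn {α : Type*} {n : ℕ} (f : Fin n → α) (P : α → Bool) :
    (List.ofFn f).countP P = weight fun t => P (f t) := by
  induction n with
  | zero => rfl
  | succ n ih =>
    rw [List.ofFn_succ, List.countP_cons, ih, weight, weight, Fin.sum_univ_succ, Nat.add_comm]

theorem pexp_iid_uniform {C : Type*} [Fintype C] [Nonempty C] (n : ℕ) (φ : List C → ℝ≥0∞) :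
    pexp (iid ((PMF.uniformOfFintype C).map fun c => [c]) n) φ =
      (Fintype.card (Fin n → C) : ℝ≥0∞)⁻¹ * ∑ cs : Fin n → C, φ (List.ofFn cs) := by
  induction n generalizing φ with
  | zero => simp [iid_zero, pexp_pure]
  | succ n ih =>
    simp only [iid_succ, pexp_bind, pexp_map, ih, List.singleton_append]
    rw [pexp_uniformOfFintype, ← Finset.mul_sum, ← mul_assoc]
    congr 1
    · rw [← ENNReal.mul_inv (by simp) (by simp)]
      simp [pow_succ, mul_comm]
    · rw [← Fintype.sum_prod_type']
      refine Fintype.sum_equiv (Fin.consEquiv fun _ => C) _ _ fun x => ?_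
      simp [List.ofFn_succ]

/-! ### How often a phase offers a rarely attacked child. -/

section Phase

variable {ι : Type*} [Fintype ι] [DecidableEq ι]

/-- The coins of a phase for which no child in `J` receives a word in `G`. -/
noncomputable def failing {n : ℕ} (J : Finset ι) (G : Finset (Fin n → Bool)) :
    Finset (Fin n → ι → Bool) :=
  Finset.univ.filter fun γ => ∀ i ∈ J, (fun t => γ t i) ∉ G

/-- The words of distinct children are independent: the failing coins form a product over the
children. -/
theorem card_failing {n : ℕ} (J : Finset ι) (G : Finset (Fin n → Bool)) :
    ((failing J G).card : ℝ) =
      (1 - (G.card : ℝ) / 2 ^ n) ^ J.card * Fintype.card (Fin n → ι → Bool) := by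
  have h1 : (failing J G).card =
      (Fintype.piFinset fun i : ι => if i ∈ J then Gᶜ else Finset.univ).card := by
    refine Finset.card_equiv (Equiv.piComm fun (_ : Fin n) (_ : ι) => Bool) fun γ => ?_
    simp only [failing, Finset.mem_filter, Finset.mem_univ, true_and, Fintype.mem_piFinset]
    refine forall_congr' fun i => ?_
    by_cases hi : i ∈ J
    · simp only [hi, true_imp_iff, if_true, Finset.mem_compl]
      rfl
    · simp [hi]
  have h2 : Fintype.card (Fin n → ι → Bool) = ∏ _i : ι, 2 ^ n := by
    simp [← pow_mul, mul_comm]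
  have hG : ((Gᶜ.card : ℕ) : ℝ) = (1 - (G.card : ℝ) / 2 ^ n) * 2 ^ n := by
    rw [Finset.card_compl, Nat.cast_sub (Finset.card_le_univ G)]
    have : (2 : ℝ) ^ n ≠ 0 := by positivity
    field_simp
    simp
  rw [h1, Fintype.card_piFinset, h2]
  push_cast
  have h3 : (1 - (G.card : ℝ) / 2 ^ n) ^ J.card =
      ∏ i : ι, if i ∈ J then (1 - (G.card : ℝ) / 2 ^ n) else 1 := by
    rw [Finset.prod_ite_mem, Finset.univ_inter, Finset.prod_const]
  rw [h3, ← Finset.prod_mul_distrib]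
  refine Finset.prod_congr rfl fun i _ => ?_
  by_cases hi : i ∈ J
  · simp only [hi, if_true]; exact hG
  · simp [hi]

/-- Failing does not involve the coins of `i₀`, so negating these coins preserves it and exchanges
weight with `n - weight`: the default child is still attacked `n / 2` times on average. -/
theorem sum_weight_failing {n : ℕ} (J : Finset ι) (G : Finset (Fin n → Bool)) {i₀ : ι}
    (hi₀ : i₀ ∉ J) :
    ∑ γ ∈ failing J G, (weight (fun t => γ t i₀) : ℝ) = (failing J G).card * (n / 2) := by
  let e : (Fin n → ι → Bool) → (Fin n → ι → Bool) :=
    fun γ t => Function.update (γ t) i₀ (!γ t i₀)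
  have he : ∀ γ, e (e γ) = γ := by
    intro γ; funext t i
    by_cases hi : i = i₀
    · subst hi; simp [e]
    · simp [e, hi]
  have hmem : ∀ γ ∈ failing J G, e γ ∈ failing J G := by
    intro γ hγ
    simp only [failing, Finset.mem_filter, Finset.mem_univ, true_and] at hγ ⊢
    intro i hi
    have : i ≠ i₀ := fun h => hi₀ (h ▸ hi)
    simpa [e, this] using hγ i hi
  have h1 : ∑ γ ∈ failing J G, (weight (fun t => γ t i₀) : ℝ) =
      ∑ γ ∈ failing J G, (weight (fun t => !γ t i₀) : ℝ) := by
    refine Finset.sum_bij' (fun γ _ => e γ) (fun γ _ => e γ) hmem hmem (fun γ _ => he γ)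
      (fun γ _ => he γ) fun γ _ => ?_
    simp [e]
  have h2 : ∑ γ ∈ failing J G, (weight (fun t => γ t i₀) : ℝ) +
      ∑ γ ∈ failing J G, (weight (fun t => !γ t i₀) : ℝ) = (failing J G).card * n := by
    rw [← Finset.sum_add_distrib, ← nsmul_eq_mul, ← Finset.sum_const]
    refine Finset.sum_congr rfl fun γ _ => ?_
    exact_mod_cast weight_not_add fun t => γ t i₀
  linarith

/-- Play in the default child `i₀`, except in phases where a child in `J` receives a good word. -/
theorem exists_side {n : ℕ} (J : Finset ι) (G : Finset (Fin n → Bool)) {i₀ : ι} (hi₀ : i₀ ∉ J)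
    {o : ι → ℝ} (ho : ∀ i, 0 ≤ o i) {D B : ℝ} (hD : 0 ≤ D) (hB : 0 ≤ B)
    (hG : ∀ w ∈ G, ∀ i ∈ J, weight w * o i ≤ B) :
    ∃ side : List (ι → Bool) → ι,
      pexp (iid ((PMF.uniformOfFintype (ι → Bool)).map fun c => [c]) n) (fun cs =>
        (if side cs = i₀ then 0 else 2 * ENNReal.ofReal D) +
          cs.countP (fun c => c (side cs)) * ENNReal.ofReal (o (side cs))) ≤
      ENNReal.ofReal ((1 - (G.card : ℝ) / 2 ^ n) ^ J.card * (n / 2 * o i₀) +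
        (1 - (1 - (G.card : ℝ) / 2 ^ n) ^ J.card) * (2 * D + B)) := by
  classical
  let good : List (ι → Bool) → ι → Prop :=
    fun l i => i ∈ J ∧ ∃ w ∈ G, l.map (fun c => c i) = List.ofFn w
  let side : List (ι → Bool) → ι := fun l => if h : ∃ i, good l i then h.choose else i₀
  refine ⟨side, ?_⟩
  have hgood : ∀ (γ : Fin n → ι → Bool) (i : ι),
      good (List.ofFn γ) i ↔ i ∈ J ∧ (fun t => γ t i) ∈ G := by
    intro γ i
    simp only [good, List.map_ofFn, List.ofFn_inj]
    refine and_congr_right fun _ => ⟨?_, fun h => ⟨_, h, rfl⟩⟩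
    rintro ⟨w, hw, h⟩
    rw [← h] at hw
    exact hw
  rw [pexp_iid_uniform]
  simp only [countP_ofFn]
  set N : ℝ := (Fintype.card (Fin n → ι → Bool) : ℝ) with hN
  have hNpos : 0 < N := by rw [hN]; exact_mod_cast Fintype.card_pos
  let cost : (Fin n → ι → Bool) → ℝ := fun γ =>
    if γ ∈ failing J G then weight (fun t => γ t i₀) * o i₀ else 2 * D + B
  have hcost : ∀ γ : Fin n → ι → Bool,
      (if side (List.ofFn γ) = i₀ then 0 else 2 * ENNReal.ofReal D) +
        (weight fun t => γ t (side (List.ofFn γ)) : ℕ) *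
          ENNReal.ofReal (o (side (List.ofFn γ))) ≤ ENNReal.ofReal (cost γ) := by
    intro γ
    by_cases hγ : γ ∈ failing J G
    · have hs : side (List.ofFn γ) = i₀ := by
        refine dif_neg ?_
        rintro ⟨i, hi⟩
        rw [hgood] at hi
        simp only [failing, Finset.mem_filter, Finset.mem_univ, true_and] at hγ
        exact hγ i hi.1 hi.2
      rw [hs]
      simp only [if_true, zero_add, cost, hγ]
      rw [ENNReal.ofReal_mul (Nat.cast_nonneg _), ENNReal.ofReal_natCast]
    · have hex : ∃ i, good (List.ofFn γ) i := by
        simp only [failing, Finset.mem_filter, Finset.mem_univ, true_and, not_forall,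
          not_not] at hγ
        obtain ⟨i, hi, h⟩ := hγ
        exact ⟨i, (hgood γ i).2 ⟨hi, h⟩⟩
      have hs : good (List.ofFn γ) (side (List.ofFn γ)) := by
        simp only [side, dif_pos hex]; exact hex.choose_spec
      rw [hgood] at hs
      simp only [cost, hγ, if_false]
      rw [ENNReal.ofReal_add (by positivity) hB, ENNReal.ofReal_mul zero_le_two,
        ← ENNReal.ofReal_natCast, ← ENNReal.ofReal_mul (Nat.cast_nonneg _)]
      refine add_le_add ?_ (ENNReal.ofReal_le_ofReal (hG _ hs.2 _ hs.1))
      split_ifs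
      · exact zero_le
      · simp
  have hsum : ∑ γ, cost γ = N * ((1 - (G.card : ℝ) / 2 ^ n) ^ J.card * (n / 2 * o i₀) +
        (1 - (1 - (G.card : ℝ) / 2 ^ n) ^ J.card) * (2 * D + B)) := by
    have h1 : ∑ γ, cost γ = ∑ γ ∈ failing J G, weight (fun t => γ t i₀) * o i₀ +
        ∑ γ ∈ (failing J G)ᶜ, (2 * D + B) := by
      rw [← Finset.sum_add_sum_compl (failing J G)]
      congr 1
      · exact Finset.sum_congr rfl fun γ hγ => by simp [cost, hγ]
      · refine Finset.sum_congr rfl fun γ hγ => ?_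
        rw [Finset.mem_compl] at hγ
        simp [cost, hγ]
    rw [h1, ← Finset.sum_mul, sum_weight_failing J G hi₀, Finset.sum_const, nsmul_eq_mul,
      Finset.card_compl, Nat.cast_sub (Finset.card_le_univ _), card_failing]
    ring
  calc _ ≤ (Fintype.card (Fin n → ι → Bool) : ℝ≥0∞)⁻¹ * ∑ γ, ENNReal.ofReal (cost γ) := by
        gcongr with γ; exact hcost γ
    _ = ENNReal.ofReal (N⁻¹ * ∑ γ, cost γ) := by
        have hc : ∀ γ, 0 ≤ cost γ := by
          intro γ; simp only [cost]; split_ifs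
          · exact mul_nonneg (Nat.cast_nonneg _) (ho _)
          · positivity
        rw [ENNReal.ofReal_mul (by positivity), ENNReal.ofReal_inv_of_pos hNpos,
          ENNReal.ofReal_sum_of_nonneg fun γ _ => hc γ, hN, ENNReal.ofReal_natCast]
    _ = _ := by rw [hsum, ← mul_assoc, inv_mul_cancel₀ hNpos.ne', one_mul]

end Phase

/-! ### Lower tails of sums of fair coins -/

theorem weight_append {m n : ℕ} (v : Fin m → Bool) (w : Fin n → Bool) :
    weight (Fin.append v w) = weight v + weight w := by
  simp only [weight, Fin.sum_univ_add, Fin.append_left, Fin.append_right]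

/-- `2 * weight w - n` is a walk with steps `±1`; this is its recursion, from which the moments
follow by induction. -/
theorem sum_words_succ {n : ℕ} (f : ℝ → ℝ) :
    ∑ w : Fin (n + 1) → Bool, f (2 * weight w - (n + 1 : ℕ)) =
      ∑ w : Fin n → Bool, (f (2 * weight w - n + 1) + f (2 * weight w - n - 1)) := by
  rw [← Fintype.sum_equiv (Fin.consEquiv fun _ => Bool)
    (fun x => f (2 * weight (Fin.cons x.1 x.2 : Fin (n + 1) → Bool) - (n + 1 : ℕ))) _
    (fun x => rfl), Fintype.sum_prod_type, Fintype.sum_bool, ← Finset.sum_add_distrib]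
  refine Finset.sum_congr rfl fun w _ => ?_
  simp only [weight, Fin.sum_univ_succ, Fin.cons_zero, Fin.cons_succ]
  push_cast
  congr 2 <;> · simp; ring

theorem sum_words_sq (n : ℕ) :
    ∑ w : Fin n → Bool, (2 * (weight w : ℝ) - n) ^ 2 = (n : ℝ) * 2 ^ n := by
  induction n with
  | zero => simp [weight]
  | succ n ih =>
    rw [sum_words_succ fun x => x ^ 2]
    calc _ = ∑ w : Fin n → Bool, (2 * (2 * (weight w : ℝ) - n) ^ 2 + 2) :=
          Finset.sum_congr rfl fun w _ => by ring
      _ = _ := by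
          rw [Finset.sum_add_distrib, ← Finset.mul_sum, ih]
          simp
          ring

theorem sum_words_pow_four (n : ℕ) :
    ∑ w : Fin n → Bool, (2 * (weight w : ℝ) - n) ^ 4 = (3 * (n : ℝ) ^ 2 - 2 * n) * 2 ^ n := by
  induction n with
  | zero => simp [weight]
  | succ n ih =>
    rw [sum_words_succ fun x => x ^ 4]
    calc _ = ∑ w : Fin n → Bool, (2 * (2 * (weight w : ℝ) - n) ^ 4 +
            12 * (2 * (weight w : ℝ) - n) ^ 2 + 2) :=
          Finset.sum_congr rfl fun w _ => by ring
      _ = _ := by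
          rw [Finset.sum_add_distrib, Finset.sum_add_distrib, ← Finset.mul_sum, ← Finset.mul_sum,
            ih, sum_words_sq]
          simp
          ring

/-- A fair coin falls short of its mean by half a standard deviation with constant probability. -/
theorem card_light_words {l : ℕ} (hl : 0 < l) :
    (1 / 10 : ℝ) * 2 ^ (l ^ 2) ≤ ((Finset.univ.filter fun w : Fin (l ^ 2) → Bool =>
      (weight w : ℝ) ≤ (l : ℝ) ^ 2 / 2 - l / 4).card : ℝ) := by
  set n := l ^ 2 with hn
  have hnl : (n : ℝ) = (l : ℝ) ^ 2 := by rw [hn]; push_cast; ring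
  have hl' : (0 : ℝ) < l := by exact_mod_cast hl
  have hn0 : (0 : ℝ) < n := by rw [hnl]; positivity
  set P : (Fin n → Bool) → Prop := fun w => (weight w : ℝ) ≤ (l : ℝ) ^ 2 / 2 - l / 4 with hP
  have hflip : ∑ w : Fin n → Bool, (if P w then (1 : ℝ) else 0) =
      ∑ w : Fin n → Bool, (if P (fun t => !w t) then (1 : ℝ) else 0) := by
    refine Fintype.sum_equiv (Equiv.piCongrRight fun _ => Equiv.boolNot) _ _ fun w => ?_
    simp
  -- With `z = y / (4 * n)`, the left side `2 * z - z ^ 2 = 1 - (1 - z) ^ 2` is at most one, and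
  -- nonpositive for `z ≤ 0`, so it lies below the indicator of the two tails. Its mean, from the
  -- second and fourth moments, exceeds `1 / 5`; symmetry gives each tail half of it.
  have hpt : ∀ w : Fin n → Bool,
      2 * ((2 * (weight w : ℝ) - n) ^ 2 - n / 4) / (4 * n) -
        ((2 * (weight w : ℝ) - n) ^ 2 - n / 4) ^ 2 / (4 * n) ^ 2 ≤
      (if P w then (1 : ℝ) else 0) + (if P (fun t => !w t) then (1 : ℝ) else 0) := by
    intro w
    set s := 2 * (weight w : ℝ) - n with hs
    set y := s ^ 2 - n / 4 with hy
    have hnot : (weight (fun t => !w t) : ℝ) = n - weight w := by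
      have := weight_not_add w
      rw [eq_sub_iff_add_eq, add_comm]
      exact_mod_cast this
    by_cases h1 : P w
    · have : 2 * y / (4 * n) - y ^ 2 / (4 * n) ^ 2 ≤ 1 := by
        have : 2 * y / (4 * n) - y ^ 2 / (4 * n) ^ 2 = 1 - (1 - y / (4 * n)) ^ 2 := by
          field_simp; ring
        rw [this]; nlinarith [sq_nonneg (1 - y / (4 * n))]
      simp only [h1, if_true]
      split_ifs <;> linarith
    · by_cases h2 : P (fun t => !w t)
      · have : 2 * y / (4 * n) - y ^ 2 / (4 * n) ^ 2 ≤ 1 := by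
          have : 2 * y / (4 * n) - y ^ 2 / (4 * n) ^ 2 = 1 - (1 - y / (4 * n)) ^ 2 := by
            field_simp; ring
          rw [this]; nlinarith [sq_nonneg (1 - y / (4 * n))]
        simp only [h1, h2, if_true, if_false]
        linarith
      · simp only [h1, h2, if_false]
        simp only [hP, hnot, not_le] at h1 h2
        have ha : -(l : ℝ) / 2 < s := by rw [hs, hnl]; linarith
        have hb : s < (l : ℝ) / 2 := by rw [hs, hnl]; rw [hnl] at h2; linarith
        have hy0 : y ≤ 0 := by rw [hy, hnl]; nlinarith
        have e1 : 2 * y / (4 * n) ≤ 0 := div_nonpos_of_nonpos_of_nonneg (by linarith) (by positivity)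
        have e2 : 0 ≤ y ^ 2 / (4 * (n : ℝ)) ^ 2 := by positivity
        linarith
  have hsum := Finset.sum_le_sum fun w (_ : w ∈ (Finset.univ : Finset (Fin n → Bool))) => hpt w
  rw [Finset.sum_add_distrib, ← hflip] at hsum
  have hL : ∑ w : Fin n → Bool, (2 * ((2 * (weight w : ℝ) - n) ^ 2 - n / 4) / (4 * n) -
        ((2 * (weight w : ℝ) - n) ^ 2 - n / 4) ^ 2 / (4 * n) ^ 2) ≥ (1 / 5) * 2 ^ n := by
    have : ∀ w : Fin n → Bool, (2 * ((2 * (weight w : ℝ) - n) ^ 2 - n / 4) / (4 * n) -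
        ((2 * (weight w : ℝ) - n) ^ 2 - n / 4) ^ 2 / (4 * n) ^ 2) =
        (1 / (2 * n) + 1 / (32 * n)) * (2 * (weight w : ℝ) - n) ^ 2 +
        (-1 / (16 * (n : ℝ) ^ 2)) * (2 * (weight w : ℝ) - n) ^ 4 + (-(1 / 8) - 1 / 256) := by
      intro w; field_simp; ring
    rw [Finset.sum_congr rfl fun w _ => this w, Finset.sum_add_distrib, Finset.sum_add_distrib,
      ← Finset.mul_sum, ← Finset.mul_sum, sum_words_sq, sum_words_pow_four]
    simp only [Finset.sum_const, Finset.card_univ, Fintype.card_fun, Fintype.card_bool,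
      Fintype.card_fin, nsmul_eq_mul]
    push_cast
    have hp : (0 : ℝ) < 2 ^ n := by positivity
    have : (1 / (2 * (n : ℝ)) + 1 / (32 * n)) * (n * 2 ^ n) +
        -1 / (16 * (n : ℝ) ^ 2) * ((3 * (n : ℝ) ^ 2 - 2 * n) * 2 ^ n) +
        2 ^ n * (-(1 / 8) - 1 / 256) = (55 / 256 + 1 / (8 * n)) * 2 ^ n := by
      field_simp; ring
    rw [this]
    have : 0 < 1 / (8 * (n : ℝ)) := by positivity
    nlinarith
  rw [Finset.card_filter]
  push_cast
  linarith

/-- Words of `k` blocks of length `l ^ 2` in which all blocks are light. -/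
theorem exists_light_words {l : ℕ} (hl : 0 < l) (k : ℕ) :
    ∃ G : Finset (Fin (l ^ 2 * k) → Bool), (1 / 10 : ℝ) ^ k * 2 ^ (l ^ 2 * k) ≤ G.card ∧
      ∀ w ∈ G, (weight w : ℝ) ≤ k * ((l : ℝ) ^ 2 / 2 - l / 4) := by
  induction k with
  | zero => exact ⟨Finset.univ, by simp, fun w _ => by simp [weight]⟩
  | succ k ih =>
    obtain ⟨G, hG, hw⟩ := ih
    set H := Finset.univ.filter fun w : Fin (l ^ 2) → Bool =>
      (weight w : ℝ) ≤ (l : ℝ) ^ 2 / 2 - l / 4 with hH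
    refine ⟨(G ×ˢ H).map (Fin.appendEquiv (l ^ 2 * k) (l ^ 2)).toEmbedding, ?_, ?_⟩
    · rw [Finset.card_map, Finset.card_product, Nat.mul_succ, pow_succ, pow_add]
      push_cast
      have := card_light_words hl
      rw [← hH] at this
      calc _ = ((1 / 10 : ℝ) ^ k * 2 ^ (l ^ 2 * k)) * (1 / 10 * 2 ^ (l ^ 2)) := by ring
        _ ≤ _ := by gcongr
    · intro w hw'
      simp only [Finset.mem_map, Finset.mem_product] at hw'
      obtain ⟨⟨a, b⟩, ⟨ha, hb⟩, rfl⟩ := hw'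
      have h1 := hw a ha
      have h2 : (weight b : ℝ) ≤ (l : ℝ) ^ 2 / 2 - l / 4 := by simpa [hH] using hb
      have : weight ((Fin.appendEquiv (l ^ 2 * k) (l ^ 2)).toEmbedding (a, b)) =
        weight a + weight b := weight_append a b
      have h3 : ((weight ((Fin.appendEquiv (l ^ 2 * k) (l ^ 2)).toEmbedding (a, b)) : ℕ) : ℝ) ≤
          ((k + 1 : ℕ) : ℝ) * ((l : ℝ) ^ 2 / 2 - l / 4) := by
        rw [this]
        push_cast
        linarith
      exact h3

/-! ### The gain of a star -/

/-- The expected offline cost of a phase, in units of the online cost of an attack, when the words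
in `G` occur with probability `η` and `N` children may receive one. -/
noncomputable def phaseRate (n N : ℕ) (η r B : ℝ) : ℝ :=
  (1 - η) ^ N * (n / (2 * r)) + (1 - (1 - η) ^ N) * (96 + B)

theorem one_sub_pow_le {η x : ℝ} (hx : 0 ≤ x) (hxη : x ≤ η) (hη : η ≤ 1) (N : ℕ) :
    (1 - η) ^ N ≤ 1 / (1 + N * x) := by
  have h1 : (1 - η) ^ N ≤ Real.exp (-(N * x)) := by
    calc (1 - η) ^ N ≤ (Real.exp (-x)) ^ N := by
          refine pow_le_pow_left₀ (by linarith) ?_ N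
          linarith [Real.add_one_le_exp (-x)]
      _ = _ := by rw [← Real.exp_nat_mul]; ring_nf
  refine h1.trans ?_
  rw [Real.exp_neg, ← one_div]
  have : 0 ≤ (N : ℝ) * x := by positivity
  refine one_div_le_one_div_of_le (by linarith) ?_
  linarith [Real.add_one_le_exp ((N : ℝ) * x)]

theorem min_half_le {y q : ℝ} (hy : 0 ≤ y) (hq : q ≤ 1 / (1 + y)) :
    min (1 / 2) (y / 2) ≤ 1 - q := by
  rcases le_total y 1 with h | h
  · have : 1 / (1 + y) ≤ 1 - y / 2 := by
      rw [div_le_iff₀ (by linarith)]; nlinarith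
    exact (min_le_right _ _).trans (by linarith)
  · have : 1 / (1 + y) ≤ 1 / 2 := one_div_le_one_div_of_le (by norm_num) (by linarith)
    exact (min_le_left _ _).trans (by linarith)

theorem card_div_two_pow_le_one {n : ℕ} (G : Finset (Fin n → Bool)) :
    (G.card : ℝ) / 2 ^ n ≤ 1 := by
  rw [div_le_one (by positivity)]
  have := Finset.card_le_univ G
  simp only [Fintype.card_fun, Fintype.card_bool, Fintype.card_fin] at this
  exact_mod_cast this

/-- Phases of many rounds: the gain comes from moderate deviations. -/
theorem phaseRate_light {r g : ℝ} {L N : ℕ} (hL : 1 ≤ L) (hLr : 4 * (L : ℝ) ≤ r) (hg : 0 ≤ g)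
    (hgain : g ≤ min (1 / 2) (N * (1 / 10 : ℝ) ^ (9216 * L) / 2) * (L / 6)) :
    ∃ n : ℕ, 0 < n ∧ ∃ G : Finset (Fin n → Bool), ∃ B : ℝ, 0 ≤ B ∧
      (∀ w ∈ G, ∀ s : ℝ, r - L ≤ s → weight w ≤ B * s) ∧
      phaseRate n N ((G.card : ℝ) / 2 ^ n) r B ≤ n / (2 * (r + g)) := by
  have hL' : (1 : ℝ) ≤ L := by exact_mod_cast hL
  have hr : 0 < r := by linarith
  -- The `k = 9216 * L` light blocks fall short of the mean by `k * l / 4`. Half of this absorbs the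
  -- ratio loss `L`, worth `n * L / (2 * r)`, by `4 * l * L ≤ r`; the other half is at least `144 *
  -- r`, by `r ≤ 8 * l * L`.
  set l := ⌊r / (4 * L)⌋₊ with hl
  have hl1 : 1 ≤ l := by
    rw [hl, Nat.one_le_floor_iff, le_div_iff₀ (by positivity)]; linarith
  have hl1' : (1 : ℝ) ≤ l := by exact_mod_cast hl1
  have hup : (l : ℝ) * (4 * L) ≤ r := by
    rw [← le_div_iff₀ (by positivity)]; exact Nat.floor_le (by positivity)
  have hlow : r ≤ (l : ℝ) * (8 * L) := by
    have := Nat.lt_floor_add_one (r / (4 * L))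
    rw [← hl, div_lt_iff₀ (by positivity)] at this
    nlinarith
  set k := 9216 * L with hk
  have hk' : (k : ℝ) = 9216 * L := by rw [hk]; push_cast; ring
  have hwords := exists_light_words (l := l) hl1 k
  generalize hn : l ^ 2 * k = n at hwords
  obtain ⟨G, hG, hw⟩ := hwords
  have hn' : (n : ℝ) = (l : ℝ) ^ 2 * k := by rw [← hn]; push_cast; ring
  have hnpos : (0 : ℝ) < n := by rw [hn', hk']; positivity
  have hkl : 1152 * r ≤ k * l := by rw [hk']; nlinarith
  have hnL : (n : ℝ) * L ≤ 576 * r ^ 2 := by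
    rw [hn', hk']
    have : ((l : ℝ) * (4 * L)) ^ 2 ≤ r ^ 2 := pow_le_pow_left₀ (by positivity) hup 2
    nlinarith
  have hnl : (n : ℝ) * L / (2 * r) ≤ k * l / 8 := by
    rw [div_le_iff₀ (by positivity), hn']
    have : 0 ≤ (k : ℝ) * l := by positivity
    nlinarith
  have hbig : 288 * r ≤ n := by
    rw [hn']; nlinarith
  -- Adding 96 for the moves leaves `n / (2 * r) - 48`: each successful phase saves 48 units.
  refine ⟨n, by exact_mod_cast hnpos, G, n / (2 * r) - 144, ?_, ?_, ?_⟩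
  · have : 144 ≤ (n : ℝ) / (2 * r) := by rw [le_div_iff₀ (by positivity)]; linarith
    linarith
  · intro w hwG s hs
    refine (hw w hwG).trans ?_
    have hB : 0 ≤ (n : ℝ) / (2 * r) - 144 := by
      have : 144 ≤ (n : ℝ) / (2 * r) := by rw [le_div_iff₀ (by positivity)]; linarith
      linarith
    refine le_trans ?_ (mul_le_mul_of_nonneg_left hs hB)
    have e : ((n : ℝ) / (2 * r) - 144) * (r - L) =
        n / 2 - n * L / (2 * r) - 144 * r + 144 * L := by field_simp; ring
    rw [e, hn'] at *
    nlinarith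
  · set η := (G.card : ℝ) / 2 ^ n with hη
    have hη1 : (1 / 10 : ℝ) ^ k ≤ η := by rw [hη, le_div_iff₀ (by positivity)]; exact hG
    have hq := one_sub_pow_le (by positivity) hη1 (card_div_two_pow_le_one G) N
    have hP := min_half_le (by positivity) hq
    set q := (1 - η) ^ N with hqdef
    have hPg : g ≤ (1 - q) * (L / 6) := hgain.trans (by gcongr)
    have e : phaseRate n N η r (n / (2 * r) - 144) = n / (2 * r) - 48 * (1 - q) := by
      rw [phaseRate, ← hqdef]; ring
    rw [e]
    have e2 : (n : ℝ) / (2 * r) - n / (2 * (r + g)) = n * g / (2 * r * (r + g)) := by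
      field_simp; ring
    have e3 : n * g / (2 * r * (r + g)) ≤ 48 * (1 - q) := by
      rw [div_le_iff₀ (by positivity)]
      have h1 : 0 ≤ 1 - q := by
        by_contra h
        have : (1 - q) * ((L : ℝ) / 6) < 0 := mul_neg_of_neg_of_pos (by linarith) (by positivity)
        linarith
      calc (n : ℝ) * g ≤ n * ((1 - q) * (L / 6)) := by gcongr
        _ = (n * L) * ((1 - q) / 6) := by ring
        _ ≤ (576 * r ^ 2) * ((1 - q) / 6) := by gcongr
        _ = 48 * (1 - q) * (2 * r * r) := by ring
        _ ≤ _ := by gcongr; linarith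
    linarith

/-- Phases with a child that is never attacked. -/
theorem phaseRate_zero {n N : ℕ} {r g : ℝ} (hr : 1 ≤ r) (hg : 0 ≤ g) (hn : 384 * r ≤ n)
    (H : g ≤ r / 2 * min (1 / 2) (N * (1 / 2 : ℝ) ^ n / 2) ∨
      (n ≤ 192 * (1 + N * (1 / 2 : ℝ) ^ n) ∧ r + g ≤ n / 384)) :
    ∃ n : ℕ, 0 < n ∧ ∃ G : Finset (Fin n → Bool), ∃ B : ℝ, 0 ≤ B ∧
      (∀ w ∈ G, ∀ s : ℝ, 0 ≤ s → weight w ≤ B * s) ∧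
      phaseRate n N ((G.card : ℝ) / 2 ^ n) r B ≤ n / (2 * (r + g)) := by
  have hnpos : (0 : ℝ) < n := by linarith
  refine ⟨n, by exact_mod_cast hnpos, {fun _ => false}, 0, le_rfl, ?_, ?_⟩
  · intro w hw s _
    rw [Finset.mem_singleton] at hw
    simp [hw, weight]
  · have hη : (((({fun _ => false} : Finset (Fin n → Bool)).card : ℕ) : ℝ)) / 2 ^ n =
        (1 / 2 : ℝ) ^ n := by simp
    have hη1 : (1 / 2 : ℝ) ^ n ≤ 1 := pow_le_one₀ (by norm_num) (by norm_num)
    rw [hη]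
    have hq := one_sub_pow_le (x := (1 / 2 : ℝ) ^ n) (by positivity) le_rfl hη1 N
    have hP := min_half_le (by positivity) hq
    have hq0 : 0 ≤ (1 - (1 / 2 : ℝ) ^ n) ^ N := pow_nonneg (by linarith) N
    have hq1 : (1 - (1 / 2 : ℝ) ^ n) ^ N ≤ 1 :=
      pow_le_one₀ (by linarith) (by linarith [show (0 : ℝ) ≤ (1 / 2) ^ n by positivity])
    rw [phaseRate]
    set q := (1 - (1 / 2 : ℝ) ^ n) ^ N with hqdef
    have hrg : 0 < r + g := by linarith
    rcases H with H | ⟨H1, H2⟩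
    -- The default phase costs at least 192 and the round trip 96, so a success saves at least half.
    · have hPg : g ≤ r / 2 * (1 - q) := H.trans (by gcongr)
      have h96 : 96 ≤ (n : ℝ) / (2 * r) / 2 := by
        rw [div_div, le_div_iff₀ (by positivity)]; linarith
      have h1 : q * (n / (2 * r)) + (1 - q) * (96 + 0) ≤ n / (2 * r) * (1 - (1 - q) / 2) := by
        nlinarith
      refine h1.trans ?_
      rw [div_mul_eq_mul_div, div_le_div_iff₀ (by positivity) (by positivity)]
      have h2 : (1 - (1 - q) / 2) * (r + g) ≤ r := by nlinarith
      nlinarith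
    -- Failure is so rare here that the default phases contribute no more than the moves do.
    · have h1 : q * (n / (2 * r)) ≤ 96 := by
        have hy : 0 < 1 + N * (1 / 2 : ℝ) ^ n := by positivity
        have hqn : q * n ≤ 192 := by
          calc q * n ≤ 1 / (1 + N * (1 / 2 : ℝ) ^ n) * (192 * (1 + N * (1 / 2 : ℝ) ^ n)) := by
                gcongr
            _ = 192 := by field_simp
        rw [← mul_div_assoc, div_le_iff₀ (by positivity)]
        nlinarith
      have h2 : 192 ≤ (n : ℝ) / (2 * (r + g)) := by
        rw [le_div_iff₀ (by positivity)]; linarith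
      nlinarith

set_option maxHeartbeats 400000 in
/-- A child whose ratio is within `δ` of the best one, together with `N - 1` others that are at
least as good, improves the best ratio `r`. -/
theorem exists_gain : ∃ c C : ℝ, 0 < c ∧ 0 < C ∧ ∀ (r δ : ℝ) (N : ℕ), 1 ≤ r → 0 ≤ δ →
    δ ≤ r - 1 → ∃ n : ℕ, 0 < n ∧ ∃ G : Finset (Fin n → Bool), ∃ B : ℝ, 0 ≤ B ∧
      (∀ w ∈ G, ∀ s : ℝ, r - δ ≤ s → weight w ≤ B * s) ∧
      phaseRate n N ((G.card : ℝ) / 2 ^ n) r B ≤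
        n / (2 * (r + c * min (Real.log (N + 1)) ((N + 1) * Real.exp (-(C * δ))))) := by
  obtain ⟨C₆, hC₆⟩ : ∃ x, x = 9216 * Real.log 10 := ⟨_, rfl⟩
  have hC₆0 : 0 < C₆ := by rw [hC₆]; have := Real.log_pos (x := 10) (by norm_num); linarith
  -- `2 * C₆` is for light words, `4 * 6144` for zero words: when `Λ = log j / C`, their
  -- probabilities stay above constant multiples of `j ^ (-1/2)` and `j ^ (-1/4)`.
  obtain ⟨C, hC⟩ : ∃ x, x = 2 * C₆ + 4 * 6144 := ⟨_, rfl⟩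
  have hC0 : 24576 ≤ C := by linarith
  obtain ⟨c, hc⟩ : ∃ x, x = Real.exp (-C) / (12 * C) := ⟨_, rfl⟩
  have hc0 : 0 < c := by rw [hc]; positivity
  have hc1 : c ≤ 1 / (12 * C) := by
    rw [hc]; gcongr; exact Real.exp_le_one_iff.2 (by linarith)
  have hc1' : c * (12 * C) ≤ 1 := by rwa [le_div_iff₀ (by positivity)] at hc1
  have hc2 : c ≤ Real.exp (-C) / 48 := by rw [hc]; gcongr; linarith
  refine ⟨c, C, hc0, by linarith, fun r δ N hr hδ hδr => ?_⟩
  have hten : ∀ L : ℕ, (1 / 10 : ℝ) ^ (9216 * L) = Real.exp (-(C₆ * L)) := by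
    intro L
    rw [one_div, inv_pow, Real.exp_neg, hC₆]
    congr 1
    rw [← Real.rpow_natCast, Real.rpow_def_of_pos (by norm_num)]
    congr 1
    push_cast
    ring
  have hhalf : ∀ n : ℕ, Real.exp (-n) ≤ (1 / 2 : ℝ) ^ n := by
    intro n
    have h1 : Real.exp (-(n : ℝ)) = Real.exp (-1) ^ n := by
      rw [← Real.exp_nat_mul]; ring_nf
    rw [h1]
    refine pow_le_pow_left₀ (Real.exp_pos _).le ?_ n
    rw [Real.exp_neg, ← one_div]
    exact one_div_le_one_div_of_le (by norm_num) (by linarith [Real.add_one_le_exp (1 : ℝ)])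
  rcases Nat.eq_zero_or_pos N with hN | hN
  · refine ⟨1, one_pos, ∅, 0, le_rfl, by simp, ?_⟩
    subst hN
    have : min (Real.log (((0 : ℕ) : ℝ) + 1)) ((((0 : ℕ) : ℝ) + 1) * Real.exp (-(C * δ))) = 0 := by
      simp [(Real.exp_pos _).le]
    rw [this]
    simp [phaseRate]
  have hN' : (1 : ℝ) ≤ N := by exact_mod_cast hN
  obtain ⟨j, hj⟩ : ∃ x : ℝ, x = N + 1 := ⟨_, rfl⟩
  rw [← hj]
  have hj2 : 2 ≤ j := by linarith
  have hNj : j / 2 ≤ N := by linarith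
  have hlogj : 0 ≤ Real.log j := Real.log_nonneg (by linarith)
  have hjexp : Real.exp (Real.log j) = j := Real.exp_log (by linarith)
  set g := c * min (Real.log j) (j * Real.exp (-(C * δ))) with hg
  have hg0 : 0 ≤ g := by
    have : 0 ≤ j * Real.exp (-(C * δ)) := by positivity
    exact mul_nonneg hc0.le (le_min hlogj this)
  have hg1 : g ≤ c * Real.log j := mul_le_mul_of_nonneg_left (min_le_left _ _) hc0.le
  have hg2 : g ≤ c * (j * Real.exp (-(C * δ))) :=
    mul_le_mul_of_nonneg_left (min_le_right _ _) hc0.le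
  set Λ := max (1 + δ) (Real.log j / C) with hΛ
  have hΛ1 : 1 ≤ Λ := le_trans (by linarith) (le_max_left _ _)
  have hΛδ : 1 + δ ≤ Λ := le_max_left _ _
  have hlogΛ : Real.log j ≤ C * Λ := by
    have := le_max_right (1 + δ) (Real.log j / C)
    rw [← hΛ, div_le_iff₀ (by linarith)] at this
    linarith
  have hgΛ : g ≤ Λ / 12 := by
    calc g ≤ c * Real.log j := hg1
      _ ≤ c * (C * Λ) := by gcongr
      _ = c * (12 * C) * (Λ / 12) := by ring
      _ ≤ 1 * (Λ / 12) := by gcongr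
      _ = _ := one_mul _
  by_cases hcase : 4 * (Λ + 1) ≤ r
  · set L := ⌈Λ⌉₊ with hL
    have hLΛ : Λ ≤ L := Nat.le_ceil _
    have hLΛ' : (L : ℝ) < Λ + 1 := Nat.ceil_lt_add_one (by linarith)
    have hL1 : 1 ≤ L := by
      have : (1 : ℝ) ≤ L := hΛ1.trans hLΛ
      exact_mod_cast this
    obtain ⟨n, hn, G, B, hB, hw, hrate⟩ := phaseRate_light (r := r) (g := g) (L := L) (N := N) hL1
      (by linarith) hg0 (by
        rw [hten, min_mul_of_nonneg _ _ (by positivity)]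
        refine le_min (by linarith) ?_
        have hlow : j / 24 * Real.exp (-(C₆ * L)) ≤
            N * Real.exp (-(C₆ * L)) / 2 * (L / 6) := by
          have hL1' : (1 : ℝ) ≤ L := by exact_mod_cast hL1
          calc j / 24 * Real.exp (-(C₆ * L)) = j / 2 * Real.exp (-(C₆ * L)) / 2 * (1 / 6) := by
                ring
            _ ≤ _ := by gcongr
        refine le_trans ?_ hlow
        rcases le_total (Real.log j / C) (1 + δ) with h | h
        · have hΛe : Λ = 1 + δ := max_eq_left h
          have h1 : -C + -(C * δ) ≤ -(C₆ * L) := by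
            have : C₆ * L ≤ C₆ * (2 + δ) := by gcongr; linarith
            have : C₆ * δ ≤ C * δ := by gcongr; linarith
            nlinarith
          calc g ≤ c * (j * Real.exp (-(C * δ))) := hg2
            _ ≤ Real.exp (-C) / 48 * (j * Real.exp (-(C * δ))) := by gcongr
            _ = j / 48 * Real.exp (-C + -(C * δ)) := by rw [Real.exp_add]; ring
            _ ≤ j / 24 * Real.exp (-(C₆ * L)) := by gcongr; norm_num
        · have hΛe : Λ = Real.log j / C := max_eq_right h
          have h1 : -C₆ + -(Real.log j / 2) ≤ -(C₆ * L) := by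
            have h2 : C₆ * (Real.log j / C) ≤ Real.log j / 2 := by
              rw [mul_div_assoc', div_le_div_iff₀ (by linarith) (by norm_num)]
              nlinarith
            have : C₆ * L ≤ C₆ * (Real.log j / C + 1) := by gcongr; linarith
            nlinarith
          have h3 : Real.log j / 2 ≤ Real.exp (Real.log j / 2) := by
            linarith [Real.add_one_le_exp (Real.log j / 2)]
          calc g ≤ c * Real.log j := hg1
            _ ≤ Real.exp (-C) / 48 * Real.log j := by gcongr
            _ ≤ Real.exp (-C₆) / 48 * Real.log j := by gcongr; linarith
            _ = Real.exp (-C₆) / 24 * (Real.log j / 2) := by ring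
            _ ≤ Real.exp (-C₆) / 24 * Real.exp (Real.log j / 2) := by gcongr
            _ = j / 24 * Real.exp (-C₆ + -(Real.log j / 2)) := by
                have : Real.exp (Real.log j / 2) = j * Real.exp (-(Real.log j / 2)) := by
                  nth_rewrite 2 [← hjexp]
                  rw [← Real.exp_add]; ring_nf
                rw [this, Real.exp_add]; ring
            _ ≤ _ := by gcongr)
    refine ⟨n, hn, G, B, hB, fun w hwG s hs => hw w hwG s ?_, hrate⟩
    linarith
  · push Not at hcase
    have hrΛ : r ≤ 8 * Λ := by linarith
    -- As `r ≤ 8 * Λ` and `g ≤ Λ / 12`, this yields `384 * (r + g) ≤ n` with room to spare.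
    set n := ⌈6144 * Λ⌉₊ with hn
    have hnl : 6144 * Λ ≤ n := Nat.le_ceil _
    have hnu : (n : ℝ) < 6144 * Λ + 1 := Nat.ceil_lt_add_one (by linarith)
    obtain ⟨n', hn', G, B, hB, hw, hrate⟩ := phaseRate_zero (n := n) (N := N) (r := r) (g := g) hr
      hg0 (by linarith) (by
        rcases le_total (Real.log j / C) (1 + δ) with h | h
        · left
          have hΛe : Λ = 1 + δ := max_eq_left h
          rw [mul_min_of_nonneg _ _ (by linarith)]
          refine le_min (by linarith) ?_
          have h1 : -C + -(C * δ) ≤ -n := by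
            have : 6144 * δ ≤ C * δ := by gcongr; linarith
            linarith
          calc g ≤ c * (j * Real.exp (-(C * δ))) := hg2
            _ ≤ Real.exp (-C) / 48 * (j * Real.exp (-(C * δ))) := by gcongr
            _ = 1 / 2 * (j / 2 * Real.exp (-C + -(C * δ)) / 2 / 6) := by
                rw [Real.exp_add]; ring
            _ ≤ r / 2 * (N * (1 / 2 : ℝ) ^ n / 2 / 1) := by
                gcongr
                · exact (Real.exp_le_exp.2 h1).trans (hhalf n)
                · norm_num
            _ = _ := by ring
        · right
          have hΛe : Λ = Real.log j / C := max_eq_right h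
          refine ⟨?_, by linarith⟩
          have h1 : (n : ℝ) ≤ Real.log j / 4 + 1 := by
            have : 6144 * Λ ≤ Real.log j / 4 := by
              rw [hΛe, mul_div_assoc', div_le_div_iff₀ (by linarith) (by norm_num)]
              nlinarith
            linarith
          have h2 : Real.exp (-1) * Real.exp (-(Real.log j / 4)) ≤ (1 / 2 : ℝ) ^ n := by
            rw [← Real.exp_add]
            exact (Real.exp_le_exp.2 (by linarith)).trans (hhalf n)
          have h3 : (1 / 3 : ℝ) ≤ Real.exp (-1) := by
            rw [Real.exp_neg, ← one_div]
            exact one_div_le_one_div_of_le (Real.exp_pos _) Real.exp_one_lt_three.le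
          have h4 : Real.log j / 4 + 1 ≤ j * Real.exp (-(Real.log j / 4)) := by
            have : j * Real.exp (-(Real.log j / 4)) = Real.exp (3 * Real.log j / 4) := by
              nth_rewrite 1 [← hjexp]
              rw [← Real.exp_add]; ring_nf
            rw [this]
            linarith [Real.add_one_le_exp (3 * Real.log j / 4)]
          have h5 : (1 / 6 : ℝ) * (j * Real.exp (-(Real.log j / 4))) ≤ N * (1 / 2 : ℝ) ^ n := by
            calc _ = j / 2 * (1 / 3 * Real.exp (-(Real.log j / 4))) := by ring
              _ ≤ N * (Real.exp (-1) * Real.exp (-(Real.log j / 4))) := by gcongr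
              _ ≤ _ := by gcongr
          linarith)
    refine ⟨n', hn', G, B, hB, fun w hwG s hs => hw w hwG s ?_, hrate⟩
    linarith

/-! ### Combining adversaries -/

section Ratio

variable {V : Type*} [MetricSpace V]

/-- There is an adversary on `A` at scale `D` that forces the competitive ratio `r`. -/
def HasRatio (A : Finset V) (D r : ℝ) : Prop :=
  ∃ p : PMF (List (Task V)), IsAdversary A p (ENNReal.ofReal (D / 48)) (ENNReal.ofReal (D / 16))
    (ENNReal.ofReal (D / (48 * r)))

theorem hasRatio_singleton (v : V) {D : ℝ} (hD : 0 ≤ D) : HasRatio {v} D 1 :=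
  ⟨_, (isAdversary_singleton v (ENNReal.ofReal (D / 48))).mono
    (ENNReal.ofReal_le_ofReal (by linarith)) (ENNReal.ofReal_le_ofReal (by rw [mul_one]))⟩

theorem hasRatio_star {ι : Type*} [Fintype ι] [DecidableEq ι] {A : ι → Finset V} {X : Finset V}
    (hX : ∀ x, x ∈ X ↔ ∃ i, x ∈ A i) (hne : ∀ i, (A i).Nonempty) {D : ℝ} (hD : 0 < D)
    (hdist : ∀ i j, i ≠ j → ∀ x ∈ A i, ∀ y ∈ A j, D / 16 ≤ dist x y ∧ dist x y ≤ D)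
    {r : ι → ℝ} (hr : ∀ i, 0 < r i) (h : ∀ i, HasRatio (A i) D (r i)) {i₀ : ι} {J : Finset ι}
    (hi₀ : i₀ ∉ J) {n : ℕ} (hn : 0 < n) {G : Finset (Fin n → Bool)} {B : ℝ} (hB : 0 ≤ B)
    (hG : ∀ w ∈ G, ∀ i ∈ J, weight w ≤ B * r i) {r' : ℝ} (hr' : 0 < r')
    (hrate : phaseRate n J.card ((G.card : ℝ) / 2 ^ n) (r i₀) B ≤ n / (2 * r')) :
    HasRatio X (2 * D) r' := by
  choose p hp using h
  have hdisj : ∀ i j, i ≠ j → Disjoint (A i) (A j) := by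
    intro i j hij
    refine Finset.disjoint_left.2 fun x hx hx' => ?_
    have := (hdist i j hij x hx x hx').1
    rw [dist_self] at this
    linarith
  obtain ⟨side, hside⟩ := exists_side J G hi₀ (o := fun i => D / (48 * r i))
    (fun i => by have := hr i; positivity) hD.le (B := D / 48 * B) (by positivity)
    (fun w hw i hi => by
      have := hr i
      rw [mul_div_assoc', div_le_iff₀ (by positivity)]
      have h1 := mul_le_mul_of_nonneg_left (hG w hw i hi) hD.le
      linarith)
  have hstar : IsAdversary X (star A p) (ENNReal.ofReal (D / 48) / 2) (ENNReal.ofReal (D / 16))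
      (ENNReal.ofReal (D / (96 * r'))) := by
    constructor
    · refine star_online hX (ENNReal.ofReal_le_ofReal (by linarith)) (fun i => (hp i).online) ?_
      intro i j hij x hx y hy
      rw [edist_dist]
      exact ENNReal.ofReal_le_ofReal (hdist i j hij x hx y hy).1
    · refine star_offline hX hne hdisj i₀ ENNReal.ofReal_ne_top ?_ (fun i => (hp i).offline) hn side
        (hside.trans ?_)
      · intro i hi x hx y hy
        rw [edist_dist]
        exact ENNReal.ofReal_le_ofReal (hdist i i₀ hi x hx y hy).2
      · rw [← ENNReal.ofReal_natCast, ← ENNReal.ofReal_mul (Nat.cast_nonneg _)]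
        refine ENNReal.ofReal_le_ofReal ?_
        have h0 := hr i₀
        calc _ = D / 48 * phaseRate n J.card ((G.card : ℝ) / 2 ^ n) (r i₀) B := by
              rw [phaseRate]; field_simp; ring
          _ ≤ D / 48 * (n / (2 * r')) := by gcongr
          _ = _ := by field_simp; norm_num
  -- One round forces `D / 96`, so four force `2 * D / 48`, as scale `2 * D` requires. The exit
  -- charge grows to `D / 16 + D / 24`, still below `2 * D / 16`.
  refine ⟨iid (star A p) 4, ?_⟩
  have h4 := hstar.iid 4
  have e1 : ((4 : ℕ) : ℝ≥0∞) * (ENNReal.ofReal (D / 48) / 2) = ENNReal.ofReal (2 * D / 48) := by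
    rw [← ENNReal.ofReal_ofNat 2, ← ENNReal.ofReal_div_of_pos two_pos, ← ENNReal.ofReal_natCast,
      ← ENNReal.ofReal_mul (Nat.cast_nonneg _)]
    congr 1
    push_cast
    ring
  rw [e1] at h4
  refine h4.mono ?_ ?_
  · rw [← ENNReal.ofReal_add (by positivity) (by positivity)]
    exact ENNReal.ofReal_le_ofReal (by linarith)
  · rw [← ENNReal.ofReal_natCast, ← ENNReal.ofReal_mul (Nat.cast_nonneg _)]
    refine ENNReal.ofReal_le_ofReal (le_of_eq ?_)
    push_cast
    field_simp
    norm_num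

theorem sum_range_indicator_le (x : ℝ) (hx : 0 ≤ x) (m : ℕ) :
    ∑ i ∈ Finset.range m, (if ((i : ℝ) + 1 ≤ x) then (1 : ℝ) else 0) ≤ x := by
  induction m with
  | zero => simpa using hx
  | succ m ih =>
    by_cases h : (m : ℝ) + 1 ≤ x
    · calc _ ≤ ∑ i ∈ Finset.range (m + 1), (1 : ℝ) :=
            Finset.sum_le_sum fun i _ => by split_ifs <;> norm_num
        _ = m + 1 := by simp
        _ ≤ x := h
    · rw [Finset.sum_range_succ]
      simpa [h] using ih

theorem sum_range_inv_sq_le (m : ℕ) :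
    ∑ i ∈ Finset.range (m + 1), (if i = 0 then (0 : ℝ) else 1 / ((i : ℝ) + 1) ^ 2) ≤
      1 - 1 / (m + 1) := by
  induction m with
  | zero => simp
  | succ m ih =>
    rw [Finset.sum_range_succ]
    simp only [Nat.succ_ne_zero, if_false]
    push_cast
    have : 1 / ((m : ℝ) + 1 + 1) ^ 2 ≤ 1 / (m + 1) - 1 / (m + 1 + 1) := by
      rw [div_sub_div _ _ (by positivity) (by positivity),
        div_le_div_iff₀ (by positivity) (by positivity)]
      nlinarith
    linarith

/-- The exponential sum over children whose gains are all at most `x`. -/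
theorem sum_exp_le {m : ℕ} {C x : ℝ} (hx : 0 ≤ x) (δ : ℕ → ℝ)
    (h : ∀ i < m + 1, min (Real.log (i + 1)) ((i + 1) * Real.exp (-(C * δ i))) ≤ x)
    (hδ : ∀ i < m + 1, 0 ≤ δ i) {C' : ℝ} (hC' : 2 * C ≤ C') (hC'0 : 0 ≤ C') :
    ∑ i ∈ Finset.range (m + 1), Real.exp (-(C' * δ i)) ≤ Real.exp (2 * x) := by
  have hterm : ∀ i ∈ Finset.range (m + 1), Real.exp (-(C' * δ i)) ≤
      (if ((i : ℝ) + 1 ≤ Real.exp x) then (1 : ℝ) else 0) +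
        x ^ 2 * (if i = 0 then (0 : ℝ) else 1 / ((i : ℝ) + 1) ^ 2) := by
    intro i hi
    rw [Finset.mem_range] at hi
    by_cases h1 : (i : ℝ) + 1 ≤ Real.exp x
    · simp only [h1, if_true]
      have h2 : Real.exp (-(C' * δ i)) ≤ 1 :=
        Real.exp_le_one_iff.2 (by have := mul_nonneg hC'0 (hδ i hi); linarith)
      have h3 : 0 ≤ x ^ 2 * (if i = 0 then (0 : ℝ) else 1 / ((i : ℝ) + 1) ^ 2) := by
        split_ifs <;> positivity
      linarith
    · have hi0 : i ≠ 0 := by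
        rintro rfl
        exact h1 (by simpa using hx)
      simp only [h1, hi0, if_false, zero_add]
      have hpos : (0 : ℝ) < (i : ℝ) + 1 := by positivity
      have hlog : x < Real.log (i + 1) := by
        rw [Real.lt_log_iff_exp_lt hpos]; linarith
      have h2 : (i + 1) * Real.exp (-(C * δ i)) ≤ x :=
        (min_le_iff.1 (h i hi)).resolve_left (by linarith)
      have h3 : Real.exp (-(C * δ i)) ≤ x / (i + 1) := by
        rw [le_div_iff₀ hpos]; linarith
      -- `2 * C ≤ C'` squares the bound `x / (i + 1)`, which makes it summable; in total `exp x + x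
      -- ^ 2 ≤ exp (2 * x)`.
      calc Real.exp (-(C' * δ i)) ≤ Real.exp (-(C * δ i)) ^ 2 := by
            rw [← Real.exp_nat_mul, Real.exp_le_exp]
            have := mul_le_mul_of_nonneg_right hC' (hδ i hi)
            push_cast
            linarith
        _ ≤ (x / (i + 1)) ^ 2 := by gcongr
        _ = _ := by rw [div_pow]; ring
  refine (Finset.sum_le_sum hterm).trans ?_
  rw [Finset.sum_add_distrib, ← Finset.mul_sum]
  have h1 := sum_range_indicator_le (Real.exp x) (Real.exp_pos x).le (m + 1)
  have h2 : ∑ i ∈ Finset.range (m + 1), (if i = 0 then (0 : ℝ) else 1 / ((i : ℝ) + 1) ^ 2) ≤ 1 :=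
    (sum_range_inv_sq_le m).trans (by
      have : (0 : ℝ) ≤ 1 / (m + 1) := by positivity
      linarith)
  have h3 : x ^ 2 * _ ≤ x ^ 2 * 1 := mul_le_mul_of_nonneg_left h2 (sq_nonneg x)
  have h4 := Real.add_one_le_exp x
  have h5 : Real.exp (2 * x) = Real.exp x * Real.exp x := by rw [← Real.exp_add]; ring_nf
  rw [h5]
  nlinarith

/-- The exponentials of the ratios of the children of a star add up. -/
theorem exists_hasRatio_star : ∃ C : ℝ, 0 < C ∧ ∀ {V : Type*} [MetricSpace V] (m : ℕ)
    (A : Fin (m + 1) → Finset V) (X : Finset V), (∀ x, x ∈ X ↔ ∃ i, x ∈ A i) →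
    (∀ i, (A i).Nonempty) → ∀ D : ℝ, 0 < D →
    (∀ i j, i ≠ j → ∀ x ∈ A i, ∀ y ∈ A j, D / 16 ≤ dist x y ∧ dist x y ≤ D) →
    ∀ r : Fin (m + 1) → ℝ, Antitone r → (∀ i, 1 ≤ r i) → (∀ i, HasRatio (A i) D (r i)) →
    ∃ r' : ℝ, 1 ≤ r' ∧ HasRatio X (2 * D) r' ∧ ∑ i, Real.exp (C * r i) ≤ Real.exp (C * r') := by
  obtain ⟨c, C, hc, hC, H⟩ := exists_gain
  -- `2 / c` turns the gain `c * val i` into the exponent `2 * val i`; `2 * C` is what `sum_exp_le`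
  -- needs.
  refine ⟨2 / c + 2 * C, by positivity, ?_⟩
  intro V _ m A X hX hne D hD hdist r hanti hr h
  let val : Fin (m + 1) → ℝ := fun i =>
    min (Real.log ((i : ℕ) + 1)) (((i : ℕ) + 1) * Real.exp (-(C * (r 0 - r i))))
  -- Children `0, …, i` are used for the most profitable `i`. Maximality bounds the gaps of all
  -- other children too.
  obtain ⟨i, -, hi⟩ := Finset.exists_max_image Finset.univ val ⟨0, Finset.mem_univ _⟩
  have hval : 0 ≤ val i := by
    refine le_min (Real.log_nonneg ?_) (by positivity)
    have : (0 : ℝ) ≤ (i : ℕ) := Nat.cast_nonneg _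
    linarith
  have hδ : ∀ i, 0 ≤ r 0 - r i := fun i => sub_nonneg.2 (hanti (Fin.zero_le i))
  obtain ⟨n, hn, G, B, hB, hG, hrate⟩ := H (r 0) (r 0 - r i) i (hr 0) (hδ i) (by linarith [hr i])
  refine ⟨r 0 + c * val i, ?_, ?_, ?_⟩
  · have := mul_nonneg hc.le hval
    linarith [hr 0]
  · refine hasRatio_star hX hne hD hdist (fun i => by linarith [hr i]) h (i₀ := 0)
      (J := Finset.Ioc 0 i) (by simp) hn hB (fun w hw k hk => hG w hw (r k) ?_) ?_ ?_
    · have := hanti (Finset.mem_Ioc.1 hk).2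
      linarith
    · have := mul_nonneg hc.le hval
      linarith [hr 0]
    · have hcard : (Finset.Ioc 0 i).card = (i : ℕ) := by simp
      rw [hcard]
      exact hrate
  · set C' := 2 / c + 2 * C with hC'
    have hC'0 : 0 ≤ C' := by positivity
    let δ : ℕ → ℝ := fun k => if hk : k < m + 1 then r 0 - r ⟨k, hk⟩ else 0
    have hδk : ∀ k (hk : k < m + 1), δ k = r 0 - r ⟨k, hk⟩ := fun k hk => dif_pos hk
    have hsum := sum_exp_le (m := m) (C := C) hval δ
      (fun k hk => by
        rw [hδk k hk]
        exact hi ⟨k, hk⟩ (Finset.mem_univ _))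
      (fun k hk => by rw [hδk k hk]; exact hδ ⟨k, hk⟩)
      (by linarith [show 0 ≤ 2 / c by positivity]) hC'0
    rw [← Fin.sum_univ_eq_sum_range (fun k => Real.exp (-(C' * δ k)))] at hsum
    calc ∑ i, Real.exp (C' * r i) = Real.exp (C' * r 0) * ∑ i : Fin (m + 1),
          Real.exp (-(C' * δ i)) := by
          rw [Finset.mul_sum]
          refine Finset.sum_congr rfl fun k _ => ?_
          rw [← Real.exp_add, hδk k k.2]
          congr 1
          ring
      _ ≤ Real.exp (C' * r 0) * Real.exp (2 * val i) := by gcongr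
      _ ≤ _ := by
          rw [← Real.exp_add, Real.exp_le_exp, mul_add]
          have : 2 * val i ≤ C' * (c * val i) := by
            have e : C' * (c * val i) = 2 * val i + 2 * C * c * val i := by
              rw [hC']; field_simp
            have : 0 ≤ 2 * C * c * val i := by positivity
            linarith
          linarith

end Ratio

/-! ### Hierarchically separated subsets -/

section Hierarchy

variable {V : Type*} [MetricSpace V]

/-- A hierarchically separated set of `n` levels: on level `n`, the parts of the next lower level
have mutual distances between `δ * 2 ^ n / 16` and `δ * 2 ^ n`. -/
def Hierarchical (δ : ℝ) : ℕ → Finset V → Prop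
  | 0, S => ∃ v, S = {v}
  | n + 1, S => ∃ P : Finset (Finset V), P.Nonempty ∧ (∀ p ∈ P, Hierarchical δ n p) ∧
      (∀ p ∈ P, ∀ q ∈ P, p ≠ q → ∀ x ∈ p, ∀ y ∈ q,
        δ * 2 ^ (n + 1) / 16 ≤ dist x y ∧ dist x y ≤ δ * 2 ^ (n + 1)) ∧
      ∀ x, x ∈ S ↔ ∃ p ∈ P, x ∈ p

/-- Every hierarchically separated set carries an adversary that forces a ratio logarithmic in its
size. -/
theorem exists_hasRatio_of_hierarchical : ∃ C : ℝ, 0 < C ∧ ∀ {V : Type*} [MetricSpace V] (δ : ℝ),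
    0 < δ → ∀ (n : ℕ) (S : Finset V), Hierarchical δ n S →
    ∃ S' ⊆ S, S'.Nonempty ∧ ∃ r : ℝ, 1 ≤ r ∧ HasRatio S' (δ * 2 ^ (n + 1)) r ∧
      (S.card : ℝ) ≤ Real.exp (C * r) := by
  classical
  obtain ⟨C, hC, H⟩ := exists_hasRatio_star
  refine ⟨C, hC, ?_⟩
  intro V _ δ hδ n
  induction n with
  | zero =>
    rintro S ⟨v, rfl⟩
    refine ⟨{v}, subset_rfl, by simp, 1, le_rfl, hasRatio_singleton v (by positivity), ?_⟩
    simpa using hC.le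
  | succ n ih =>
    rintro S ⟨P, hP, hPn, hsep, hS⟩
    have hex : ∀ p : P, ∃ S' ⊆ (p : Finset V), S'.Nonempty ∧ ∃ r : ℝ, 1 ≤ r ∧
        HasRatio S' (δ * 2 ^ (n + 1)) r ∧ ((p : Finset V).card : ℝ) ≤ Real.exp (C * r) :=
      fun p => ih p (hPn p p.2)
    choose A hAsub hAne r hr hratio hcard using hex
    obtain ⟨m, hm⟩ : ∃ m, P.card = m + 1 := Nat.exists_eq_succ_of_ne_zero (Finset.card_pos.2 hP).ne'
    let e : Fin (m + 1) ≃ P := (finCongr hm.symm).trans P.equivFin.symm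
    let f : Fin (m + 1) ≃ P := (Tuple.sort fun i => -r (e i)).trans e
    have hanti : Antitone fun i => r (f i) := by
      intro i j hij
      have := Tuple.monotone_sort (fun i => -r (e i)) hij
      simp only [Function.comp] at this
      simp only [f, Equiv.trans_apply]
      linarith
    obtain ⟨r', hr', hX, hsum⟩ := H m (fun i => A (f i)) (Finset.univ.biUnion fun i => A (f i))
      (by simp) (fun i => hAne _) (δ * 2 ^ (n + 1)) (by positivity)
      (fun i j hij x hx y hy => hsep _ (f i).2 _ (f j).2
        (fun h => hij (f.injective (Subtype.ext h))) x (hAsub _ hx) y (hAsub _ hy))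
      (fun i => r (f i)) hanti (fun i => hr _) (fun i => hratio _)
    refine ⟨Finset.univ.biUnion fun i => A (f i), ?_, ?_, r', hr', ?_, ?_⟩
    · intro x hx
      obtain ⟨i, -, hi⟩ := Finset.mem_biUnion.1 hx
      exact (hS x).2 ⟨_, (f i).2, hAsub _ hi⟩
    · exact Finset.biUnion_nonempty.2 ⟨0, Finset.mem_univ _, hAne _⟩
    · have e1 : δ * 2 ^ (n + 1 + 1) = 2 * (δ * 2 ^ (n + 1)) := by ring
      rw [e1]
      exact hX
    · have hSeq : S = P.biUnion id := by
        ext x; simp [hS]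
      calc (S.card : ℝ) ≤ ∑ p ∈ P, (p.card : ℝ) := by
            rw [hSeq]
            exact_mod_cast Finset.card_biUnion_le
        _ = ∑ p : P, ((p : Finset V).card : ℝ) := (Finset.sum_coe_sort P _).symm
        _ = ∑ i, ((f i : Finset V).card : ℝ) := (f.sum_comp fun p : P => ((p : Finset V).card : ℝ)).symm
        _ ≤ ∑ i, Real.exp (C * r (f i)) := Finset.sum_le_sum fun i _ => hcard _
        _ ≤ _ := hsum

theorem Hierarchical.lift {δ : ℝ} {n : ℕ} {S : Finset V} (h : Hierarchical δ n S) :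
    Hierarchical δ (n + 1) S :=
  ⟨{S}, by simp, by simpa using h, by simp +contextual, by simp⟩

open Classical in
theorem Hierarchical.union {δ : ℝ} {n : ℕ} {S T : Finset V} (hS : Hierarchical δ n S)
    (hT : Hierarchical δ (n + 1) T)
    (hd : ∀ x ∈ S, ∀ y ∈ T, δ * 2 ^ (n + 1) / 16 ≤ dist x y ∧ dist x y ≤ δ * 2 ^ (n + 1)) :
    Hierarchical δ (n + 1) (S ∪ T) := by
  obtain ⟨P, -, hPn, hsep, hmem⟩ := hT
  refine ⟨insert S P, by simp, ?_, ?_, ?_⟩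
  · intro p hp
    rcases Finset.mem_insert.1 hp with rfl | hp
    · exact hS
    · exact hPn p hp
  · intro p hp q hq hpq x hx y hy
    rw [Finset.mem_insert] at hp hq
    rcases hp with rfl | hp <;> rcases hq with rfl | hq
    · exact absurd rfl hpq
    · exact hd x hx y ((hmem y).2 ⟨q, hq, hy⟩)
    · rw [dist_comm]
      exact hd y hy x ((hmem x).2 ⟨p, hp, hx⟩)
    · exact hsep p hp q hq hpq x hx y hy
  · intro x
    simp [hmem]

open Classical in
/-- Every finite set of bounded diameter contains a large hierarchically separated subset. -/
theorem exists_hierarchical {δ : ℝ} (hδ : 0 < δ) (hmin : ∀ x y : V, x ≠ y → δ < dist x y) (n : ℕ) :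
    ∀ X : Finset V, X.Nonempty → (∀ x ∈ X, ∀ y ∈ X, dist x y ≤ δ * 2 ^ n) →
    ∀ N : ℕ, (∀ x ∈ X, (X.filter fun y => dist x y ≤ δ * 2 ^ n / 4).card ≤ N) →
    ∃ Y ⊆ X, Hierarchical δ n Y ∧ (X.card : ℝ) ≤ Y.card * √N := by
  induction n with
  | zero =>
    intro X hX hdiam N hN
    obtain ⟨v, hv⟩ := hX
    have hXv : X = {v} := by
      refine Finset.eq_singleton_iff_unique_mem.2 ⟨hv, fun y hy => ?_⟩
      by_contra hne
      have h1 := hmin y v hne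
      have h2 := hdiam y hy v hv
      simp only [pow_zero, mul_one] at h2
      linarith
    refine ⟨X, subset_rfl, ⟨v, hXv⟩, ?_⟩
    have h1 : 1 ≤ N := by
      refine le_trans ?_ (hN v hv)
      refine Finset.card_pos.2 ⟨v, Finset.mem_filter.2 ⟨hv, ?_⟩⟩
      rw [dist_self]; positivity
    have h2 : 1 ≤ √(N : ℝ) := Real.one_le_sqrt.2 (by exact_mod_cast h1)
    exact le_mul_of_one_le_right (Nat.cast_nonneg _) h2
  | succ n ihn =>
    intro X
    induction X using Finset.strongInduction with
    | H X ihX =>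
      intro hX hdiam N hN
      set D := δ * 2 ^ (n + 1) with hD
      have hDn : δ * 2 ^ n = D / 2 := by rw [hD]; ring
      have hD0 : 0 < D := by positivity
      let ball : V → ℝ → Finset V := fun x s => X.filter fun y => dist x y ≤ s
      have hball : ∀ x s y, y ∈ ball x s ↔ y ∈ X ∧ dist x y ≤ s := fun x s y => Finset.mem_filter
      -- Pieces of the cut ball live at diameter `D / 2`, where the relevant radius is `D / 8`: by
      -- this choice `M` can replace `N` for them.
      obtain ⟨x, hx, hmax⟩ := Finset.exists_max_image X (fun y => (ball y (D / 8)).card) hX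
      have hself : ∀ s, 0 ≤ s → x ∈ ball x s := fun s hs => (hball _ _ _).2 ⟨hx, by simpa using hs⟩
      set M := (ball x (D / 8)).card with hM
      have hM1 : 1 ≤ M := Finset.card_pos.2 ⟨x, hself _ (by positivity)⟩
      have hM0 : (0 : ℝ) < M := by exact_mod_cast hM1
      -- Cut out a ball whose boundary layer is thin.
      obtain ⟨s, hs0, hs1, hcut⟩ : ∃ s : ℝ, 0 ≤ s ∧ s ≤ 3 * D / 16 ∧
          ((ball x (s + D / 16)).card : ℝ) ^ 2 * M ≤ ((ball x s).card : ℝ) ^ 2 * N := by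
        have h4 : ((ball x (D / 4)).card : ℝ) ≤ N := by exact_mod_cast hN x hx
        set b := ((ball x (3 * D / 16)).card : ℝ) with hb
        set b' := ((ball x (D / 4)).card : ℝ) with hb'
        have hb0 : 0 ≤ b := Nat.cast_nonneg _
        have hb'0 : 0 ≤ b' := Nat.cast_nonneg _
        -- Over two layers of width `D / 16` the ball grows from `M` to `b' ≤ N`, so in one of them
        -- by a factor at most `√(N / M)`.
        rcases le_total (b ^ 2) (M * b') with h | h
        · refine ⟨D / 8, by positivity, by linarith, ?_⟩
          have e : D / 8 + D / 16 = 3 * D / 16 := by ring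
          rw [e, ← hb, ← hM]
          calc b ^ 2 * M ≤ (M * b') * M := by gcongr
            _ = (M : ℝ) ^ 2 * b' := by ring
            _ ≤ _ := by gcongr
        · refine ⟨3 * D / 16, by positivity, le_rfl, ?_⟩
          have e : 3 * D / 16 + D / 16 = D / 4 := by ring
          rw [e, ← hb', ← hb]
          calc b' ^ 2 * M = (M * b') * b' := by ring
            _ ≤ b ^ 2 * N := by gcongr
      set P := ball x s with hP
      set R := ball x (s + D / 16) with hR
      have hPX : P ⊆ X := Finset.filter_subset _ _
      have hRX : R ⊆ X := Finset.filter_subset _ _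
      obtain ⟨P', hP'P, hP'h, hP'c⟩ := ihn P ⟨x, hself s hs0⟩
        (fun y hy z hz => by
          have h1 := ((hball _ _ _).1 hy).2
          have h2 := ((hball _ _ _).1 hz).2
          have := dist_triangle_left y z x
          rw [hDn]
          linarith)
        M (fun y hy => by
          refine le_trans (Finset.card_le_card ?_) (hmax y (hPX hy))
          intro z hz
          rw [Finset.mem_filter] at hz
          refine (hball _ _ _).2 ⟨hPX hz.1, ?_⟩
          have := hz.2
          rw [hDn] at this
          linarith)
      -- The factor `√(N / M)` of the discarded layer and the `√M` of the recursion in `P` multiply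
      -- to `√N`, so the bound survives the cut.
      have hRc : (R.card : ℝ) ≤ P'.card * √N := by
        have h1 : (P.card : ℝ) ^ 2 ≤ (P'.card : ℝ) ^ 2 * M := by
          calc (P.card : ℝ) ^ 2 ≤ (P'.card * √M) ^ 2 := by gcongr
            _ = _ := by rw [mul_pow, Real.sq_sqrt hM0.le]
        have h2 : (R.card : ℝ) ^ 2 * M ≤ ((P'.card : ℝ) * √N) ^ 2 * M := by
          calc (R.card : ℝ) ^ 2 * M ≤ (P.card : ℝ) ^ 2 * N := hcut
            _ ≤ ((P'.card : ℝ) ^ 2 * M) * N := by gcongr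
            _ = _ := by rw [mul_pow, Real.sq_sqrt (Nat.cast_nonneg N)]; ring
        exact le_of_sq_le_sq (le_of_mul_le_mul_right h2 hM0) (by positivity)
      rcases (X \ R).eq_empty_or_nonempty with hQ | hQ
      · refine ⟨P', hP'P.trans hPX, hP'h.lift, ?_⟩
        have : X = R := subset_antisymm (Finset.sdiff_eq_empty_iff_subset.1 hQ) hRX
        rw [this]
        exact hRc
      · obtain ⟨Q', hQ'Q, hQ'h, hQ'c⟩ := ihX (X \ R)
          (Finset.sdiff_ssubset hRX ⟨x, hself _ (by positivity)⟩) hQ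
          (fun y hy z hz => hdiam y (Finset.mem_sdiff.1 hy).1 z (Finset.mem_sdiff.1 hz).1) N
          (fun y hy => by
            refine le_trans (Finset.card_le_card ?_) (hN y (Finset.mem_sdiff.1 hy).1)
            exact Finset.filter_subset_filter _ Finset.sdiff_subset)
        have hcross : ∀ y ∈ P', ∀ z ∈ Q', D / 16 ≤ dist y z ∧ dist y z ≤ D := by
          intro y hy z hz
          have hyP := (hball _ _ _).1 (hP'P hy)
          obtain ⟨hzX, hzR⟩ := Finset.mem_sdiff.1 (hQ'Q hz)
          refine ⟨?_, hdiam y hyP.1 z hzX⟩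
          have h1 : s + D / 16 < dist x z := by
            by_contra h
            exact hzR ((hball _ _ _).2 ⟨hzX, not_lt.1 h⟩)
          have := dist_triangle x y z
          linarith [hyP.2]
        refine ⟨P' ∪ Q', Finset.union_subset (hP'P.trans hPX) (hQ'Q.trans Finset.sdiff_subset),
          hP'h.union hQ'h hcross, ?_⟩
        have hdisj : Disjoint P' Q' := by
          refine Finset.disjoint_left.2 fun y hy hy' => ?_
          have := (hcross y hy y hy').1
          rw [dist_self] at this
          linarith
        have hXc : (X.card : ℝ) = R.card + (X \ R).card := by
          rw [add_comm]
          exact_mod_cast (Finset.card_sdiff_add_card_eq_card hRX).symm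
        rw [Finset.card_union_of_disjoint hdisj, hXc]
        push_cast
        linarith

/-- Every finite metric space contains a hierarchically separated subset of at least the square
root of its size. -/
theorem exists_hierarchical_univ [Fintype V] [Nonempty V] :
    ∃ δ : ℝ, 0 < δ ∧ ∃ (n : ℕ) (Y : Finset V), Hierarchical δ n Y ∧
      (Fintype.card V : ℝ) ≤ (Y.card : ℝ) ^ 2 := by
  classical
  obtain ⟨δ, hδ, hmin⟩ : ∃ δ : ℝ, 0 < δ ∧ ∀ x y : V, x ≠ y → δ < dist x y := by
    -- The value 1 on the diagonal keeps the minimum positive, also for a single point; halving it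
    -- makes the inequality strict.
    obtain ⟨z, -, hz⟩ := Finset.exists_min_image (Finset.univ : Finset (V × V))
      (fun z => if z.1 = z.2 then (1 : ℝ) else dist z.1 z.2) Finset.univ_nonempty
    have hpos : 0 < (if z.1 = z.2 then (1 : ℝ) else dist z.1 z.2) := by
      split_ifs with h
      · exact one_pos
      · exact dist_pos.2 h
    refine ⟨_, half_pos hpos, fun x y hxy => ?_⟩
    have := hz (x, y) (Finset.mem_univ _)
    simp only [hxy, if_false] at this
    linarith
  obtain ⟨z, -, hz⟩ := Finset.exists_max_image (Finset.univ : Finset (V × V))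
    (fun z => dist z.1 z.2) Finset.univ_nonempty
  obtain ⟨n, hn⟩ := pow_unbounded_of_one_lt (dist z.1 z.2 / δ) (one_lt_two : (1 : ℝ) < 2)
  rw [div_lt_iff₀ hδ] at hn
  obtain ⟨Y, -, hY, hc⟩ := exists_hierarchical hδ hmin n Finset.univ Finset.univ_nonempty
    (fun x _ y _ => by
      have := hz (x, y) (Finset.mem_univ _)
      simp only at this
      linarith) (Fintype.card V) (fun x _ => Finset.card_le_univ _)
  refine ⟨δ, hδ, n, Y, hY, ?_⟩
  rw [Finset.card_univ] at hc
  have hV : (0 : ℝ) < Fintype.card V := by exact_mod_cast Fintype.card_pos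
  have h1 : √(Fintype.card V : ℝ) * √(Fintype.card V : ℝ) = Fintype.card V :=
    Real.mul_self_sqrt hV.le
  have h2 : √(Fintype.card V : ℝ) ≤ Y.card := by
    have hs : 0 < √(Fintype.card V : ℝ) := Real.sqrt_pos.2 hV
    refine le_of_mul_le_mul_right ?_ hs
    linarith
  nlinarith [Real.sqrt_nonneg (Fintype.card V : ℝ)]

end Hierarchy

/-! ### From adversaries to competitive ratios -/

section Competitive

variable {V : Type*} [MetricSpace V]

open Classical in
/-- The task that agrees with `t` on `S` and makes all other states impossible. -/
noncomputable def force (S : Finset V) (t : Task V) : Task V := fun v => if v ∈ S then t v else ∞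

theorem cost_cons (t : Task V) (σ : List (Task V)) (u : ℕ → V) :
    cost (t :: σ) u = edist (u 0) (u 1) + t (u 1) + cost σ fun i => u (i + 1) := by
  simp only [cost, List.length_cons]
  rw [Fin.sum_univ_succ]
  rfl

/-- Every exit from `S` meets an infinite task, so any exit charge `γ` is dominated. -/
theorem localCost_le_cost (S : Finset V) (γ : ℝ≥0∞) (σ : List (Task V))
    (g : List (Task V) → V) :
    localCost S γ σ (fun τ => g (τ.map (force S))) ≤
      cost (σ.map (force S)) fun i => g ((σ.map (force S)).take i) := by
  induction σ generalizing g with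
  | nil => exact zero_le
  | cons t σ ih =>
    rw [List.map_cons, cost_cons, localCost]
    refine add_le_add ?_ ?_
    · simp only [List.map_nil, List.map_cons, List.take_zero, List.take_succ_cons]
      unfold stepCost
      split_ifs with h1 h2
      · simp [force, h2]
      · simp [force, h2]
      · exact zero_le
    · simpa using ih fun τ => g (force S t :: τ)

theorem optCost_cons_le (t : Task V) (σ : List (Task V)) (u v : V) :
    optCost u (t :: σ) ≤ edist u v + t v + optCost v σ := by
  rw [optCost, optCost]
  simp only [ENNReal.add_iInf]
  refine le_iInf₂ fun w hw => ?_
  let u' : ℕ → V := fun n => match n with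
    | 0 => u
    | n + 1 => w n
  refine iInf₂_le_of_le u' rfl (le_of_eq ?_)
  rw [cost_cons]
  simp only [u', hw]

theorem optCost_le_opt (S : Finset V) (σ : List (Task V)) (u : V) :
    optCost u (σ.map (force S)) ≤ opt S σ u := by
  induction σ generalizing u with
  | nil =>
    refine iInf₂_le_of_le (fun _ => u) rfl ?_
    rw [List.map_nil]
    simp [cost]
  | cons t σ ih =>
    refine le_iInf₂ fun v hv => (optCost_cons_le _ _ u v).trans ?_
    gcongr
    · simp [force, hv]
    · exact ih v

theorem measurable_cost [Fintype V] {v₀ : V} {Ω : Type*} [MeasurableSpace Ω]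
    (A : RandomizedAlgorithm V v₀ Ω) (σ : List (Task V)) :
    Measurable fun ω => cost σ fun i => A.state (σ.take i) ω := by
  let _ : MeasurableSpace V := ⊤
  have hstate : ∀ τ, Measurable (A.state τ) := fun τ =>
    measurable_to_countable' fun v => A.measurableSet_state τ v
  refine Finset.measurable_sum _ fun i _ => ?_
  exact (Measurable.of_discrete (f := fun x : V × V => edist x.1 x.2 + σ.get i x.2)).comp
    ((hstate _).prodMk (hstate _))

theorem lintegral_pexp_le {α Ω : Type*} [MeasurableSpace Ω] (P : Measure Ω) (q : PMF α)
    {f : α → Ω → ℝ≥0∞} (hf : ∀ x, Measurable (f x)) :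
    ∫⁻ ω, pexp q (fun x => f x ω) ∂P = pexp q fun x => ∫⁻ ω, f x ω ∂P := by
  have hsub : ∀ F : α → ℝ≥0∞, pexp q F = ∑' x : q.support, q x * F x := by
    intro F
    refine (tsum_subtype_eq_of_support_subset (f := fun x => q x * F x) ?_).symm
    intro x hx
    rw [PMF.mem_support_iff]
    exact left_ne_zero_of_mul hx
  -- Exchanging sum and integral needs a countable index; the mass of a discrete distribution has
  -- countable support.
  have : Countable q.support := q.support_countable.to_subtype
  simp only [hsub]
  rw [lintegral_tsum fun x : q.support => ((hf x).const_mul (q x)).aemeasurable]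
  refine tsum_congr fun x => ?_
  rw [lintegral_const_mul _ (hf x)]

/-- `T` copies force `T * D / 48` online against `T * D / (48 * r')` plus a constant offline;
averaging the competitive inequality and letting `T` grow gives the ratio. -/
theorem HasRatio.le_of_isCompetitive [Fintype V] {S : Finset V} (hS : S.Nonempty) {D r' : ℝ}
    (hD : 0 < D) (hr' : 0 < r') (h : HasRatio S D r') {v₀ : V} {Ω : Type*} [MeasurableSpace Ω]
    {P : Measure Ω} [IsProbabilityMeasure P] {A : RandomizedAlgorithm V v₀ Ω} {r : ℝ≥0}
    (hA : A.IsCompetitive P r) : r' ≤ r := by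
  obtain ⟨p, hp⟩ := h
  obtain ⟨c, hc⟩ := hA
  obtain ⟨c', hc', hoff⟩ := hp.offline
  obtain ⟨u, hu⟩ := hS
  -- An opening task that drives the algorithm from `v₀` into `S`, or else costs it infinity.
  let t₀ : Task V := force S 0
  let seq : List (Task V) → List (Task V) := fun σ => t₀ :: σ.map (force S)
  have hlow : ∀ T : ℕ, T * ENNReal.ofReal (D / 48) ≤
      pexp (iid p T) fun σ => A.expectedCost P (seq σ) := by
    intro T
    have hpt : ∀ ω, T * ENNReal.ofReal (D / 48) ≤
        pexp (iid p T) fun σ => cost (seq σ) fun i => A.state ((seq σ).take i) ω := by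
      intro ω
      by_cases h0 : A.state [t₀] ω ∈ S
      · refine ((hp.iid T).online (fun τ => A.state (t₀ :: τ.map (force S)) ω) h0).trans ?_
        refine pexp_mono _ fun σ => ?_
        rw [cost_cons]
        refine le_trans ?_ le_add_self
        simpa [seq] using localCost_le_cost S _ σ fun τ => A.state (t₀ :: τ) ω
      · have htop : ∀ σ, cost (seq σ) (fun i => A.state ((seq σ).take i) ω) = ∞ := by
          intro σ
          rw [cost_cons]
          have : t₀ (A.state ((seq σ).take 1) ω) = ∞ := by
            simp [seq, t₀, force] at h0 ⊢
            exact h0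
          rw [this]
          simp
        simp [htop, pexp_const]
    calc T * ENNReal.ofReal (D / 48) = ∫⁻ _, T * ENNReal.ofReal (D / 48) ∂P := by simp
      _ ≤ ∫⁻ ω, pexp (iid p T) (fun σ => cost (seq σ) fun i => A.state ((seq σ).take i) ω) ∂P :=
          lintegral_mono hpt
      _ = _ := lintegral_pexp_le P _ fun σ => measurable_cost A (seq σ)
  have hup : ∀ T : ℕ, pexp (iid p T) (fun σ => A.expectedCost P (seq σ)) ≤
      r * (edist v₀ u + (T * ENNReal.ofReal (D / (48 * r')) + c')) + c := by
    intro T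
    calc _ ≤ pexp (iid p T) (fun σ => r * (edist v₀ u + opt S σ u) + c) := by
          refine pexp_mono _ fun σ => (hc _).trans ?_
          gcongr
          refine (optCost_cons_le _ _ v₀ u).trans ?_
          have : t₀ u = 0 := by simp [t₀, force, hu]
          rw [this, add_zero]
          gcongr
          exact optCost_le_opt S σ u
      _ ≤ _ := by
          rw [pexp_add, pexp_const_mul, pexp_add, pexp_const, pexp_const]
          gcongr
          exact hoff T u hu
  lift c' to ℝ≥0 using hc'
  have hreal : ∀ T : ℕ, T * (D / 48) ≤
      r * (dist v₀ u + (T * (D / (48 * r')) + c')) + c := by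
    intro T
    have h1 := (hlow T).trans (hup T)
    have h2 : (T : ℝ≥0∞) * ENNReal.ofReal (D / 48) = ENNReal.ofReal (T * (D / 48)) := by
      rw [ENNReal.ofReal_mul (Nat.cast_nonneg _), ENNReal.ofReal_natCast]
    have h3 : (r : ℝ≥0∞) * (edist v₀ u + (T * ENNReal.ofReal (D / (48 * r')) + c')) + c =
        ENNReal.ofReal (r * (dist v₀ u + (T * (D / (48 * r')) + c')) + c) := by
      rw [ENNReal.ofReal_add (by positivity) (by positivity), ENNReal.ofReal_mul (by positivity),
        ENNReal.ofReal_add (by positivity) (by positivity),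
        ENNReal.ofReal_add (by positivity) (by positivity), ENNReal.ofReal_mul (by positivity),
        ENNReal.ofReal_natCast, edist_dist]
      simp
    rw [h2, h3, ENNReal.ofReal_le_ofReal_iff (by positivity)] at h1
    exact h1
  by_contra hlt
  push Not at hlt
  have hgap : 0 < D / 48 - r * (D / (48 * r')) := by
    have : D / 48 - r * (D / (48 * r')) = D / (48 * r') * (r' - r) := by field_simp
    rw [this]
    exact mul_pos (by positivity) (by linarith)
  obtain ⟨T, hT⟩ := exists_nat_gt ((r * (dist v₀ u + c') + c) / (D / 48 - r * (D / (48 * r'))))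
  rw [div_lt_iff₀ hgap] at hT
  have := hreal T
  linarith

end Competitive

end MTS

theorem mainTheorem1 :
    ∃ C : ℝ, 0 < C ∧
      ∀ (V : Type*) [MetricSpace V] [Fintype V], 3 ≤ Fintype.card V →
      ∀ (v₀ : V) (Ω : Type*) [MeasurableSpace Ω] (P : Measure Ω) [IsProbabilityMeasure P]
        (A : MTS.RandomizedAlgorithm V v₀ Ω) (r : ℝ≥0), A.IsCompetitive P r →
        C * (Real.log (Fintype.card V) / Real.log (Real.log (Fintype.card V)) ^ 2) ≤ (r : ℝ) := by
  obtain ⟨K, hK, H⟩ := MTS.exists_hasRatio_of_hierarchical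
  have hlog3 : 1 < Real.log 3 := by
    rw [Real.lt_log_iff_exp_lt (by norm_num)]
    exact Real.exp_one_lt_three
  have hll3 : 0 < Real.log (Real.log 3) := Real.log_pos hlog3
  -- The proof gives `r ≥ log N / (2 * K)`, the 2 stemming from the square root in the Ramsey step;
  -- `log (log N) ^ 2` is bounded below by its value at 3.
  refine ⟨Real.log (Real.log 3) ^ 2 / (2 * K), by positivity, ?_⟩
  intro V _ _ hV v₀ Ω _ P _ A r hA
  have : Nonempty V := ⟨v₀⟩
  obtain ⟨δ, hδ, n, Y, hY, hcard⟩ := MTS.exists_hierarchical_univ (V := V)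
  obtain ⟨S, -, hS, r', hr', hratio, hYr⟩ := H δ hδ n Y hY
  have hr : r' ≤ r := hratio.le_of_isCompetitive hS (by positivity) (by linarith) hA
  have hV' : (3 : ℝ) ≤ Fintype.card V := by exact_mod_cast hV
  set N : ℝ := (Fintype.card V : ℝ) with hN
  have hlogN : Real.log N ≤ 2 * K * r' := by
    rw [Real.log_le_iff_le_exp (by linarith)]
    calc N ≤ (Y.card : ℝ) ^ 2 := hcard
      _ ≤ Real.exp (K * r') ^ 2 := by gcongr
      _ = Real.exp (2 * K * r') := by rw [← Real.exp_nat_mul]; push_cast; ring_nf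
  have hlog3N : Real.log 3 ≤ Real.log N := Real.log_le_log (by norm_num) hV'
  have hll : Real.log (Real.log 3) ≤ Real.log (Real.log N) :=
    Real.log_le_log (by linarith) hlog3N
  have hsq : Real.log (Real.log 3) ^ 2 ≤ Real.log (Real.log N) ^ 2 := by gcongr
  have hsq0 : 0 < Real.log (Real.log N) ^ 2 := lt_of_lt_of_le (by positivity) hsq
  calc Real.log (Real.log 3) ^ 2 / (2 * K) * (Real.log N / Real.log (Real.log N) ^ 2)
      = Real.log (Real.log 3) ^ 2 / Real.log (Real.log N) ^ 2 * (Real.log N / (2 * K)) := by ring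
    _ ≤ 1 * (Real.log N / (2 * K)) := by
        have : 0 ≤ Real.log N / (2 * K) := div_nonneg (by linarith) (by positivity)
        gcongr
        exact (div_le_one hsq0).2 hsq
    _ ≤ r' := by
        rw [one_mul, div_le_iff₀ (by positivity)]
        linarith
    _ ≤ r := hr
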